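/- A Boolean function $f:\mathbb{F}_2^n\to\mathbb{F}_2$ has Walsh--Hadamard transform $W_f(y)=\sum_{x\in\mathbb{F}_2^n}(-1)^{f(x)+\langle x,y\rangle}$, $y\in\mathbb{F}_2^n$, where $\langle x,y\rangle=x_1y_1+\dots+x_ny_n$. It is called bent if $W_f(y)=\pm2^{n/2}$ for all $y$, and $1$-plateaued if $W_f(y)\in\{0,\pm2^{(n+1)/2}\}$ for all $y$. Let $\mathcal{N}(n)$ be the binary logarithm of the number of $n$-variable bent functions, and let $\mathcal{N}_0(n,1)$ be the binary logarithm of the number of $n$-variable $1$-plateaued functions that are obtained by restricting $(n+1)$-variable bent functions to hyperplanes ($n$-dimensional linear subspaces of $\mathbb{F}_2^{n+1}$, identified linearly with $\mathbb{F}_2^n$). Then, for even $n\to\infty$, $$\mathcal{N}(n)\le \mathcal{N}_0(n-1,1)+2^{n-3}(1+o(1))<\frac{11}{32}\,2^n(1+o(1)).$$ That is, there are real sequences $\varepsilon_n\to0$ and $\delta_n\to0$ such that for every even $n\ge2$ one has $\mathcal{N}(n)\le \mathcal{N}_0(n-1,1)+2^{n-3}(1+\varepsilon_n)$ and $\mathcal{N}_0(n-1,1)+2^{n-3}(1+\varepsilon_n)<\frac{11}{32}\,2^n(1+\delta_n)$.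 -/

import Mathlib

open Filter Topology

/-- The Boolean `n`-cube `𝔽ⁿ`, with coordinatewise addition modulo 2. -/
abbrev Cube (n : ℕ) : Type := Fin n → ZMod 2

/-- Boolean functions in `n` variables. -/
abbrev BoolFun (n : ℕ) : Type := Cube n → ZMod 2

/-- The Walsh--Hadamard transform `W_f(y) = ∑ₓ (-1)^(f(x) ⊕ ⟨x,y⟩)`. -/
noncomputable def walsh {n : ℕ} (f : BoolFun n) (y : Cube n) : ℝ :=
  ∑ x : Cube n, (-1 : ℝ) ^ (f x + x ⬝ᵥ y).val

/-- `f` is bent if `W_f(y) = ± 2^(n/2)` for all `y`. -/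
def IsBent {n : ℕ} (f : BoolFun n) : Prop :=
  ∀ y : Cube n, walsh f y = (2 : ℝ) ^ ((n : ℝ) / 2) ∨ walsh f y = -(2 : ℝ) ^ ((n : ℝ) / 2)

/-- `f` is `s`-plateaued if `W_f(y)` is `0` or `± 2^((n+s)/2)` for all `y`. -/
def IsPlateaued {n : ℕ} (s : ℕ) (f : BoolFun n) : Prop :=
  ∀ y : Cube n, walsh f y = (2 : ℝ) ^ (((n : ℝ) + (s : ℝ)) / 2) ∨
    walsh f y = -(2 : ℝ) ^ (((n : ℝ) + (s : ℝ)) / 2) ∨ walsh f y = 0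

/-- The `n`-variable function `f` is the restriction of the `(n+1)`-variable function `F` to some
hyperplane `Γ` (a subspace of dimension `n`), where `Γ` is identified with the `n`-cube by some
linear isomorphism. -/
def IsHyperplaneRestriction {n : ℕ} (f : BoolFun n) (F : BoolFun (n + 1)) : Prop :=
  ∃ Γ : Submodule (ZMod 2) (Cube (n + 1)), Module.finrank (ZMod 2) Γ = n ∧
    ∃ e : Cube n ≃ₗ[ZMod 2] Γ, ∀ x : Cube n, f x = F (e x : Cube (n + 1))

/-- `𝒩(n)`: the binary logarithm of the number of `n`-variable bent functions. -/
noncomputable def logNumBent (n : ℕ) : ℝ :=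
  Real.logb 2 (Nat.card {f : BoolFun n // IsBent f})

/-- `𝒩₀(n, 1)`: the binary logarithm of the number of `n`-variable `1`-plateaued functions that are
obtained by restricting `(n+1)`-variable bent functions to hyperplanes. -/
noncomputable def logNumBentRestriction (n : ℕ) : ℝ :=
  Real.logb 2 (Nat.card {f : BoolFun n //
    IsPlateaued 1 f ∧ ∃ F : BoolFun (n + 1), IsBent F ∧ IsHyperplaneRestriction f F})

/-! Let n = 2h. A function of degree at most h is determined by its values on any translate of the
Hamming ball of radius h (`LowDeg.eq_zero`). A translate can be chosen that carries at most its
proportional share of any given weight (`exists_translate_sum_le`). Bent functions and their duals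
have degree at most h once h ≥ 2 (`lowDeg_of_bent`, `walsh_dual`).

First inequality. Linear automorphisms preserve bentness, so only the hyperplane x₀ = 0 matters. Fix
a restriction f to it. At frequencies where W_f ≠ 0, the dual G of a bent extension is known on both
halves. Where W_f = 0, the two values of G are complementary, so one unknown bit remains. By
Parseval these zeros fill exactly half of the (n-1)-cube. A suitable ball translate therefore meets
them in at most half of its points, about 2^(n-3) bits (`card_bent_extensions_le`).

Second inequality. Split the (n-1)-cube into four cosets of a subspace of codimension 2. Let B ≈
2^(n-4) be the size of the ball of radius h in dimension n-3. Three coset restrictions cost at most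
B bits each, by degree. Given these three, the four Walsh signs over each y, twisted by a character
attached to the fourth coset, are known up to a common additive constant (`pat_sub_pat`). What
remains is a support bit, which has degree at most h in y and is encoded on a ball with a
variable-length code, and one sign bit for each constant nonzero pattern. The expected cost, summed
over the four choices of the fourth coset, is affine in the product of the four signs
(`sum_totalCost`). Averaging over shears makes the total of these products nonpositive
(`exists_shear_sum_planeProd_nonpos`), so some fourth coset costs at most B/2 bits
(`exists_cheapFace`, `card_cheapFace_fiber_le`). Altogether this is 7B/2 ≈ (7/32)·2^n bits, and
adding 2^(n-3) gives 11/32. -/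

/-! ### The sign character of `𝔽₂` -/

/-- The nontrivial real character of `ZMod 2`. -/
noncomputable def sgn (a : ZMod 2) : ℝ := (-1 : ℝ) ^ a.val

@[simp] lemma sgn_zero : sgn 0 = 1 := by simp [sgn]

@[simp] lemma sgn_one : sgn 1 = -1 := by simp [sgn, ZMod.val_one]

lemma zmod_two_cases (a : ZMod 2) : a = 0 ∨ a = 1 := by revert a; decide

lemma sgn_add (a b : ZMod 2) : sgn (a + b) = sgn a * sgn b := by
  rcases zmod_two_cases a with rfl | rfl <;> rcases zmod_two_cases b with rfl | rfl <;>
    simp [show (1 + 1 : ZMod 2) = 0 from rfl]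

@[simp] lemma sgn_mul_self (a : ZMod 2) : sgn a * sgn a = 1 := by
  rcases zmod_two_cases a with rfl | rfl <;> simp

lemma sgn_ne_zero (a : ZMod 2) : sgn a ≠ 0 := by
  rcases zmod_two_cases a with rfl | rfl <;> simp

lemma sgn_injective : Function.Injective sgn := by
  intro a b h
  rcases zmod_two_cases a with rfl | rfl <;> rcases zmod_two_cases b with rfl | rfl <;>
    simp at h ⊢ <;> norm_num at h

lemma sgn_eq_or (a : ZMod 2) : sgn a = 1 ∨ sgn a = -1 := by
  rcases zmod_two_cases a with rfl | rfl <;> simp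

lemma sgn_sum {ι : Type*} (s : Finset ι) (g : ι → ZMod 2) :
    sgn (∑ i ∈ s, g i) = ∏ i ∈ s, sgn (g i) := by
  classical
  induction s using Finset.induction_on with
  | empty => simp
  | insert i s hi ih => rw [Finset.sum_insert hi, Finset.prod_insert hi, sgn_add, ih]

lemma sum_sgn {ι : Type*} (s : Finset ι) (g : ι → ZMod 2) :
    ∑ i ∈ s, sgn (g i) = (s.card : ℝ) - 2 * ((s.filter fun i => g i = 1).card : ℝ) := by
  classical
  induction s using Finset.induction_on with
  | empty => simp
  | insert i s hi ih =>
    rw [Finset.sum_insert hi, Finset.filter_insert, Finset.card_insert_of_notMem hi, ih]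
    rcases zmod_two_cases (g i) with h | h
    · simp [h]; ring
    · rw [if_pos h, Finset.card_insert_of_notMem (by simp [hi]), h]
      simp; ring

lemma sum_eq_card_ones {ι : Type*} (s : Finset ι) (g : ι → ZMod 2) :
    ∑ i ∈ s, g i = ((s.filter fun i => g i = 1).card : ZMod 2) := by
  rw [Finset.card_filter, Nat.cast_sum]
  refine Finset.sum_congr rfl fun i _ => ?_
  rcases zmod_two_cases (g i) with h | h <;> simp [h]

/-! ### Splitting the cube -/

lemma sum_vecCons {M : Type*} [AddCommMonoid M] {n : ℕ} (φ : Cube (n + 1) → M) :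
    ∑ x, φ x = ∑ x : Cube n, φ (Matrix.vecCons 0 x) + ∑ x : Cube n, φ (Matrix.vecCons 1 x) := by
  rw [← (Fin.consEquiv (fun _ : Fin (n + 1) => ZMod 2)).sum_comp, Fintype.sum_prod_type]
  exact Fin.sum_univ_two (fun a : Fin 2 =>
    ∑ x : Cube n, φ ((Fin.consEquiv (fun _ : Fin (n + 1) => ZMod 2)) (a, x)))

lemma card_cube (n : ℕ) : Fintype.card (Cube n) = 2 ^ n := by
  simp [ZMod.card]

/-- The face through `x` whose free coordinates are those in `T`. -/
def face {n : ℕ} (T : Finset (Fin n)) (x : Cube n) : Finset (Cube n) :=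
  Finset.univ.filter fun z => ∀ i, i ∉ T → z i = x i

lemma mem_face {n : ℕ} {T : Finset (Fin n)} {x z : Cube n} :
    z ∈ face T x ↔ ∀ i, i ∉ T → z i = x i := by simp [face]

lemma face_univ {n : ℕ} (x : Cube n) : face Finset.univ x = Finset.univ := by
  ext z; simp [mem_face]

lemma face_empty {n : ℕ} (x : Cube n) : face ∅ x = {x} := by
  ext z; simp [mem_face, funext_iff]

lemma face_eq_piFinset {n : ℕ} (T : Finset (Fin n)) (x : Cube n) :
    face T x = Fintype.piFinset fun i => if i ∈ T then Finset.univ else {x i} := by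
  ext z
  simp only [mem_face, Fintype.mem_piFinset]
  refine forall_congr' fun i => ?_
  by_cases h : i ∈ T <;> simp [h]

lemma card_face {n : ℕ} (T : Finset (Fin n)) (x : Cube n) : (face T x).card = 2 ^ T.card := by
  rw [face_eq_piFinset, Fintype.card_piFinset]
  have : ∀ i, (if i ∈ T then (Finset.univ : Finset (ZMod 2)) else {x i}).card
      = if i ∈ T then 2 else 1 := by
    intro i; split_ifs <;> simp [ZMod.card]
  simp [this]

/-- Character sums over the face through `0` dual to `T`. -/
lemma sum_face_compl_sgn {n : ℕ} (T : Finset (Fin n)) (w : Cube n) :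
    ∑ y ∈ face Tᶜ 0, sgn (w ⬝ᵥ y) = if (∀ i, i ∉ T → w i = 0) then (2 : ℝ) ^ (n - T.card) else 0 := by
  have h1 : ∀ y : Cube n, sgn (w ⬝ᵥ y) = ∏ i, sgn (w i * y i) := fun y => sgn_sum _ _
  simp_rw [h1]
  rw [face_eq_piFinset, ← Finset.prod_univ_sum _ (fun i b => sgn (w i * b))]
  have h2 : ∀ i, (∑ b ∈ (if i ∈ Tᶜ then (Finset.univ : Finset (ZMod 2)) else {(0 : Cube n) i}),
      sgn (w i * b)) = if i ∈ T then 1 else if w i = 0 then 2 else 0 := by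
    intro i
    by_cases hi : i ∈ T
    · simp [hi]
    · have h3 : ∑ b : ZMod 2, sgn (w i * b) = sgn (w i * 0) + sgn (w i * 1) :=
        Fin.sum_univ_two (fun b : ZMod 2 => sgn (w i * b))
      simp only [Finset.mem_compl, hi, not_false_eq_true, if_true, if_false, h3]
      rcases zmod_two_cases (w i) with h | h <;> simp [h]; norm_num
  simp_rw [h2]
  split_ifs with hw
  · rw [← Finset.prod_subset (Finset.subset_univ Tᶜ)]
    · rw [Finset.prod_congr rfl (g := fun _ => (2 : ℝ))]
      · simp [Finset.card_compl]
      · intro i hi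
        have hi' : i ∉ T := by simpa using hi
        simp [hi', hw i hi']
    · intro i _ hi
      have hi' : i ∈ T := by simpa using hi
      simp [hi']
  · push Not at hw
    obtain ⟨i, hi, hwi⟩ := hw
    exact Finset.prod_eq_zero (Finset.mem_univ i) (by simp [hi, hwi])

lemma sum_sgn_dotProduct {n : ℕ} (w : Cube n) :
    ∑ y, sgn (w ⬝ᵥ y) = if w = 0 then (2 : ℝ) ^ n else 0 := by
  have h := sum_face_compl_sgn ∅ w
  simpa [face_univ, funext_iff] using h

/-! ### The Walsh transform -/

lemma walsh_eq {n : ℕ} (f : BoolFun n) (y : Cube n) :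
    walsh f y = ∑ x, sgn (f x) * sgn (x ⬝ᵥ y) :=
  Finset.sum_congr rfl fun _ _ => sgn_add _ _

lemma cube_add_self {n : ℕ} (x : Cube n) : x + x = 0 := by
  funext i; exact CharTwo.add_self_eq_zero (x i)

lemma cube_add_eq_zero {n : ℕ} {x z : Cube n} : x + z = 0 ↔ z = x := by
  refine ⟨fun h => ?_, fun h => by rw [h, cube_add_self]⟩
  calc z = (x + x) + z := by rw [cube_add_self, zero_add]
    _ = x := by rw [add_assoc, h, add_zero]

/-- Poisson summation. The case T = ∅ is Fourier inversion; large T gives the degree bound for bent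
functions. -/
lemma sum_face_compl_walsh {n : ℕ} (F : BoolFun n) (T : Finset (Fin n)) (x : Cube n) :
    ∑ y ∈ face Tᶜ 0, walsh F y * sgn (x ⬝ᵥ y) =
      (2 : ℝ) ^ (n - T.card) * ∑ z ∈ face T x, sgn (F z) := by
  have h1 : ∀ y, walsh F y * sgn (x ⬝ᵥ y) = ∑ z, sgn (F z) * sgn ((z + x) ⬝ᵥ y) := by
    intro y
    rw [walsh_eq, Finset.sum_mul]
    refine Finset.sum_congr rfl fun z _ => ?_
    rw [add_dotProduct, sgn_add]; ring
  simp_rw [h1]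
  rw [Finset.sum_comm]
  simp_rw [← Finset.mul_sum, sum_face_compl_sgn]
  rw [face, Finset.sum_filter, Finset.mul_sum]
  refine Finset.sum_congr rfl fun z _ => ?_
  have h2 : (∀ i, i ∉ T → (z + x) i = 0) ↔ ∀ i, i ∉ T → z i = x i := by
    refine forall_congr' fun i => imp_congr_right fun _ => ?_
    rw [Pi.add_apply]; exact CharTwo.add_eq_zero
  simp only [h2]
  split_ifs <;> ring

lemma walsh_inversion {n : ℕ} (F : BoolFun n) (x : Cube n) :
    ∑ y, walsh F y * sgn (x ⬝ᵥ y) = (2 : ℝ) ^ n * sgn (F x) := by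
  simpa [face_univ, face_empty] using sum_face_compl_walsh F ∅ x

lemma walsh_injective {n : ℕ} {f g : BoolFun n} (h : ∀ y, walsh f y = walsh g y) : f = g := by
  funext x
  have h1 := walsh_inversion f x
  simp_rw [h, walsh_inversion g x] at h1
  exact sgn_injective (mul_left_cancel₀ (by positivity) h1.symm)

/-- The sign of f has constant square 1, whose Fourier transform is concentrated at 0. The case a =
0 is Parseval. -/
lemma sum_walsh_mul_walsh_add {n : ℕ} (f : BoolFun n) (a : Cube n) :
    ∑ y, walsh f y * walsh f (y + a) = if a = 0 then (2 : ℝ) ^ n * 2 ^ n else 0 := by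
  have h1 : ∀ y, walsh f y * walsh f (y + a) =
      ∑ z, sgn (f z) * sgn (z ⬝ᵥ a) * (walsh f y * sgn (z ⬝ᵥ y)) := by
    intro y
    rw [walsh_eq f (y + a), Finset.mul_sum]
    refine Finset.sum_congr rfl fun z _ => ?_
    rw [dotProduct_add, sgn_add]; ring
  simp_rw [h1]
  rw [Finset.sum_comm]
  simp_rw [← Finset.mul_sum, walsh_inversion]
  have h2 : ∀ z, sgn (f z) * sgn (z ⬝ᵥ a) * (2 ^ n * sgn (f z)) = 2 ^ n * sgn (a ⬝ᵥ z) := by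
    intro z
    rw [dotProduct_comm a z]
    linear_combination (2 ^ n * sgn (z ⬝ᵥ a)) * sgn_mul_self (f z)
  simp_rw [h2]
  rw [← Finset.mul_sum, sum_sgn_dotProduct]
  split_ifs <;> simp

lemma sum_walsh_sq {n : ℕ} (f : BoolFun n) : ∑ y, walsh f y ^ 2 = (2 : ℝ) ^ n * 2 ^ n := by
  simpa [sq] using sum_walsh_mul_walsh_add f 0

lemma walsh_vecCons {n : ℕ} (F : BoolFun (n + 1)) (b : ZMod 2) (y : Cube n) :
    walsh F (Matrix.vecCons b y) = walsh (fun x => F (Matrix.vecCons 0 x)) y +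
      sgn b * walsh (fun x => F (Matrix.vecCons 1 x)) y := by
  simp only [walsh_eq]
  rw [sum_vecCons, Finset.mul_sum]
  congr 1
  · simp
  · refine Finset.sum_congr rfl fun x _ => ?_
    simp only [Matrix.cons_dotProduct_cons, one_mul, sgn_add]; ring

/-- Composition with a linear automorphism permutes the Walsh spectrum. -/
lemma exists_walsh_comp_linearEquiv {n : ℕ} (A : Cube n ≃ₗ[ZMod 2] Cube n) (f : BoolFun n)
    (y : Cube n) : ∃ y', walsh (fun x => f (A x)) y = walsh f y' := by
  refine ⟨fun i => A.symm (Pi.single i 1) ⬝ᵥ y, ?_⟩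
  simp only [walsh_eq]
  rw [← A.symm.toEquiv.sum_comp]
  refine Finset.sum_congr rfl fun x _ => ?_
  have h : A.symm x ⬝ᵥ y = x ⬝ᵥ fun i => A.symm (Pi.single i 1) ⬝ᵥ y := by
    have h1 : A.symm x = ∑ i, x i • A.symm (Pi.single i 1) := by
      conv_lhs => rw [pi_eq_sum_univ' x, map_sum]
      simp
    rw [h1, sum_dotProduct]
    simp [dotProduct, Finset.mul_sum, mul_assoc]
  simp [h]

/-! ### Functions of low degree -/

/-- `f` sums to zero over every face of dimension greater than `r`; equivalently, the algebraic
degree of `f` is at most `r`. -/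
def LowDeg {n : ℕ} (r : ℕ) (f : BoolFun n) : Prop :=
  ∀ (T : Finset (Fin n)) (x : Cube n), r < T.card → ∑ z ∈ face T x, f z = 0

lemma LowDeg.add {n r : ℕ} {f g : BoolFun n} (hf : LowDeg r f) (hg : LowDeg r g) :
    LowDeg r (fun x => f x + g x) := fun T x hT => by
  rw [Finset.sum_add_distrib, hf T x hT, hg T x hT, add_zero]

lemma lowDeg_const {n : ℕ} (r : ℕ) (c : ZMod 2) : LowDeg r (fun _ : Cube n => c) := by
  intro T x hT
  obtain ⟨k, hk⟩ := Nat.exists_eq_succ_of_ne_zero (by omega : T.card ≠ 0)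
  rw [Finset.sum_const, card_face, hk, Nat.pow_succ, mul_smul, two_smul,
    CharTwo.add_self_eq_zero, smul_zero]

lemma LowDeg.vecCons {n r : ℕ} {f : BoolFun (n + 1)} (hf : LowDeg r f) (a : ZMod 2) :
    LowDeg r (fun x : Cube n => f (Matrix.vecCons a x)) := by
  intro T x hT
  have h := hf (T.map (Fin.succEmb n)) (Matrix.vecCons a x) (by simpa using hT)
  rw [← h]
  refine Finset.sum_bij (fun z _ => Matrix.vecCons a z) ?_ ?_ ?_ ?_
  · intro z hz
    rw [mem_face] at hz ⊢
    intro i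
    refine Fin.cases (fun _ => by simp) (fun i hi => ?_) i
    simpa using hz i (by simpa using hi)
  · intro z _ z' _ h
    exact (Matrix.vecCons_inj.1 h).2
  · intro z hz
    rw [mem_face] at hz
    refine ⟨Matrix.vecTail z, ?_, ?_⟩
    · rw [mem_face]
      intro i hi
      simpa [Matrix.vecTail] using hz i.succ (by simpa using hi)
    · have h0 : z 0 = a := by simpa using hz 0 (by simp)
      rw [← h0]; exact Matrix.cons_head_tail z
  · intro z _; rfl

/-- The Hamming ball of radius `r`. -/
def hball (n r : ℕ) : Finset (Cube n) := Finset.univ.filter fun x => hammingNorm x ≤ r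

lemma mem_hball {n r : ℕ} {x : Cube n} : x ∈ hball n r ↔ hammingNorm x ≤ r := by simp [hball]

/-- Every translate of the Hamming ball of radius `r` determines functions of degree at most `r`. -/
lemma LowDeg.eq_zero {n r : ℕ} {f : BoolFun n} (hf : LowDeg r f) (τ : Cube n)
    (h0 : ∀ x ∈ hball n r, f (x + τ) = 0) (x : Cube n) : f (x + τ) = 0 := by
  induction hk : hammingNorm x using Nat.strong_induction_on generalizing x with
  | _ k ih =>
    subst hk
    by_cases hx : hammingNorm x ≤ r
    · exact h0 x (mem_hball.2 hx)
    -- On the face through x + τ whose free coordinates are the support of x, every other point is τ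
    -- plus a vector of smaller weight, so the induction kills all terms but one.
    · have h := hf (Finset.univ.filter fun i => x i ≠ 0) (x + τ) (not_le.1 hx)
      rw [← h]
      symm
      apply Finset.sum_eq_single_of_mem (x + τ) (mem_face.2 fun _ _ => rfl)
      intro z hz hne
      rw [mem_face] at hz
      have hsub : ∀ i, (z + τ) i ≠ 0 → x i ≠ 0 := by
        intro i hi hxi
        apply hi
        rw [Pi.add_apply, hz i (by simp [hxi]), Pi.add_apply, hxi, zero_add,
          CharTwo.add_self_eq_zero]
      have hlt : hammingNorm (z + τ) < hammingNorm x := by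
        refine Finset.card_lt_card (Finset.ssubset_iff_subset_ne.2 ⟨?_, ?_⟩)
        · intro i hi
          have := hsub i (by simpa using hi)
          simpa using this
        · intro heq
          apply hne
          have hzx : z + τ = x := by
            funext i
            have := Finset.ext_iff.1 heq i
            simp only [Finset.mem_filter, Finset.mem_univ, true_and] at this
            rcases zmod_two_cases ((z + τ) i) with h1 | h1 <;>
              rcases zmod_two_cases (x i) with h2 | h2 <;> simp_all
          rw [← hzx, add_assoc, cube_add_self, add_zero]
      have := ih _ hlt (z + τ) rfl
      rwa [add_assoc, cube_add_self, add_zero] at this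

lemma LowDeg.ext {n r : ℕ} {f g : BoolFun n} (hf : LowDeg r f) (hg : LowDeg r g) (τ : Cube n)
    (h : ∀ x ∈ hball n r, f (x + τ) = g (x + τ)) : f = g := by
  funext x
  have := (hf.add hg).eq_zero τ (fun x hx => CharTwo.add_eq_zero.2 (h x hx)) (x + τ)
  rw [add_assoc, cube_add_self, add_zero] at this
  exact CharTwo.add_eq_zero.1 this

lemma card_lowDeg_le {n r : ℕ} (s : Finset (BoolFun n)) (hs : ∀ f ∈ s, LowDeg r f) :
    s.card ≤ 2 ^ (hball n r).card := by
  classical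
  have h : s.card ≤ Fintype.card (hball n r → ZMod 2) := by
    rw [← Finset.card_univ]
    refine Finset.card_le_card_of_injOn (fun f x => f x.1) (fun _ _ => Finset.mem_coe.2 (Finset.mem_univ _)) ?_
    intro f hf g hg hfg
    refine (hs f hf).ext (hs g hg) 0 fun x hx => ?_
    simpa using congrFun hfg ⟨x, hx⟩
  simpa [ZMod.card] using h

/-- Some translate of the Hamming ball carries at most its proportional share of a weight. -/
lemma exists_translate_sum_le {n : ℕ} (r : ℕ) (w : Cube n → ℕ) :
    ∃ τ : Cube n, 2 ^ n * ∑ x ∈ hball n r, w (x + τ) ≤ (hball n r).card * ∑ x, w x := by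
  have h : ∑ τ : Cube n, 2 ^ n * ∑ x ∈ hball n r, w (x + τ) ≤
      ∑ _τ : Cube n, (hball n r).card * ∑ x, w x := by
    rw [← Finset.mul_sum, Finset.sum_comm]
    have h1 : ∀ x : Cube n, ∑ τ, w (x + τ) = ∑ z, w z := fun x =>
      Equiv.sum_comp (Equiv.addLeft x) w
    simp_rw [h1]
    rw [Finset.sum_const, Finset.sum_const, Finset.card_univ, card_cube, smul_eq_mul, smul_eq_mul]
  obtain ⟨τ, _, hτ⟩ := Finset.exists_le_of_sum_le Finset.univ_nonempty h
  exact ⟨τ, hτ⟩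

lemma card_hball (n r : ℕ) : (hball n r).card = ∑ i ∈ Finset.range (r + 1), n.choose i := by
  classical
  have h1 : (hball n r).card =
      ((Finset.univ : Finset (Finset (Fin n))).filter fun T => T.card ≤ r).card := by
    refine Finset.card_bij (fun x _ => Finset.univ.filter fun i => x i ≠ 0) ?_ ?_ ?_
    · intro x hx
      simpa [hammingNorm] using mem_hball.1 hx
    · intro x _ z _ h
      funext i
      have := Finset.ext_iff.1 h i
      simp only [Finset.mem_filter, Finset.mem_univ, true_and] at this
      rcases zmod_two_cases (x i) with h1 | h1 <;>
        rcases zmod_two_cases (z i) with h2 | h2 <;> simp_all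
    · intro T hT
      have h : (Finset.univ.filter fun i => (if i ∈ T then (1 : ZMod 2) else 0) ≠ 0) = T := by
        ext i; simp
      refine ⟨fun i => if i ∈ T then 1 else 0, ?_, h⟩
      rw [mem_hball]
      unfold hammingNorm
      rw [h]
      simpa using hT
  rw [h1, Finset.card_eq_sum_card_fiberwise (f := Finset.card) (t := Finset.range (r + 1))]
  · refine Finset.sum_congr rfl fun i hi => ?_
    rw [← Fintype.card_fin n, ← Finset.card_univ, ← Finset.card_powersetCard,
      Finset.card_univ, Fintype.card_fin]
    congr 1
    ext T
    simp only [Finset.mem_filter, Finset.mem_univ, true_and, Finset.mem_powersetCard,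
      Finset.subset_univ]
    have := Finset.mem_range.1 hi
    omega
  · intro T hT
    have : T.card ≤ r := by simpa using hT
    simp; omega

/-! ### Bent functions -/

lemma isBent_iff {h : ℕ} {n : ℕ} (hn : n = 2 * h) (F : BoolFun n) :
    IsBent F ↔ ∃ G : BoolFun n, ∀ y, walsh F y = 2 ^ h * sgn (G y) := by
  have hp : (2 : ℝ) ^ ((n : ℝ) / 2) = 2 ^ h := by
    rw [hn, ← Real.rpow_natCast]; congr 1; push_cast; ring
  unfold IsBent
  rw [hp]
  constructor
  · intro H
    refine ⟨fun y => if walsh F y = 2 ^ h then 0 else 1, fun y => ?_⟩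
    rcases H y with h1 | h1
    · simp [h1]
    · by_cases h2 : walsh F y = 2 ^ h
      · simp [h2]
      · dsimp only
        rw [if_neg h2, h1]; simp
  · rintro ⟨G, hG⟩ y
    rw [hG]
    rcases sgn_eq_or (G y) with h1 | h1 <;> simp [h1]

/-- The dual of a bent function has Walsh transform proportional to the sign of the function. -/
lemma walsh_dual {h n : ℕ} (hn : n = 2 * h) {F G : BoolFun n}
    (hG : ∀ y, walsh F y = 2 ^ h * sgn (G y)) (x : Cube n) :
    walsh G x = 2 ^ h * sgn (F x) := by
  have h1 := walsh_inversion F x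
  simp_rw [hG, mul_assoc] at h1
  rw [← Finset.mul_sum] at h1
  have h2 : walsh G x = ∑ y, sgn (G y) * sgn (x ⬝ᵥ y) := by
    rw [walsh_eq]
    exact Finset.sum_congr rfl fun y _ => by rw [dotProduct_comm]
  have h3 : (2 : ℝ) ^ n = 2 ^ h * 2 ^ h := by rw [hn]; ring
  rw [← h2, h3, mul_assoc] at h1
  exact mul_left_cancel₀ (by positivity) h1

/-- Rothaus' bound: a bent function in `2h` variables has degree at most `h`. -/
lemma lowDeg_of_bent {h n : ℕ} (hn : n = 2 * h) (h2 : 2 ≤ h) {F G : BoolFun n}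
    (hG : ∀ y, walsh F y = 2 ^ h * sgn (G y)) : LowDeg h F := by
  intro T x hT
  have hTn : T.card ≤ n := by simpa using Finset.card_le_univ T
  obtain ⟨e, he⟩ : ∃ e, T.card = h + 1 + e := ⟨T.card - (h + 1), by omega⟩
  have key := sum_face_compl_walsh F T x
  have hK : ∑ y ∈ face Tᶜ 0, walsh F y * sgn (x ⬝ᵥ y) =
      2 ^ h * ∑ y ∈ face Tᶜ 0, sgn (G y + x ⬝ᵥ y) := by
    rw [Finset.mul_sum]
    exact Finset.sum_congr rfl fun y _ => by rw [hG, sgn_add]; ring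
  rw [hK, sum_sgn, sum_sgn, card_face, card_face, Finset.card_compl, Fintype.card_fin] at key
  rw [sum_eq_card_ones]
  set k := ((face Tᶜ 0).filter fun y => G y + x ⬝ᵥ y = 1).card
  set w := ((face T x).filter fun z => F z = 1).card
  obtain ⟨d, hd⟩ : ∃ d, h = d + e + 1 := ⟨h - 1 - e, by omega⟩
  have hnd : n - T.card = d := by omega
  rw [hnd, he] at key
  -- Poisson summation divided by 2^(d+1), an identity between integers that is now read modulo 2.
  have key2 : (2 : ℝ) ^ e * (2 ^ d - 2 * k) + w = 2 ^ (h + e) := by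
    have h3 : (2 : ℝ) ^ h = 2 ^ d * 2 ^ e * 2 := by rw [hd]; ring
    have h4 : (2 : ℝ) ^ (h + 1 + e) = 2 * 2 ^ (h + e) := by ring
    push_cast at key
    rw [h4, h3] at key
    have h5 : (2 : ℝ) ^ d * 2 * (2 ^ e * (2 ^ d - 2 * k) + w - 2 ^ (h + e)) = 0 := by
      linear_combination key
    rcases mul_eq_zero.1 h5 with h6 | h6
    · exact absurd h6 (by positivity)
    · linear_combination h6
  have key3 : (2 : ℤ) ^ e * (2 ^ d - 2 * k) + w = 2 ^ (h + e) := by exact_mod_cast key2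
  have hev : Even w := by
    have hE1 : Even ((2 : ℤ) ^ e * (2 ^ d - 2 * k)) := by
      -- If d = 0 the bracket is odd and evenness must come from 2^e with e = h - 1; this is where h
      -- ≥ 2 is needed.
      rcases Nat.eq_zero_or_pos d with hd0 | hd0
      · exact Even.mul_right ((Int.even_pow' (by omega)).2 even_two) _
      · exact Even.mul_left (((Int.even_pow' (by omega)).2 even_two).sub (even_two_mul _)) _
    have hE2 : Even ((2 : ℤ) ^ (h + e)) := (Int.even_pow' (by omega)).2 even_two
    rw [← key3, Int.even_add] at hE2
    exact (Int.even_coe_nat w).1 (hE2.1 hE1)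
  exact (ZMod.natCast_eq_zero_iff w 2).2 hev.two_dvd

/-! ### Restrictions of bent functions to a coordinate hyperplane -/

/-- `f` is the restriction of a bent function to the hyperplane where the first coordinate
vanishes. -/
def IsBentFace {m : ℕ} (f : BoolFun m) : Prop :=
  ∃ F : BoolFun (m + 1), IsBent F ∧ ∀ x, f x = F (Matrix.vecCons 0 x)

lemma IsBent.comp_linearEquiv {n : ℕ} {F : BoolFun n} (hF : IsBent F)
    (A : Cube n ≃ₗ[ZMod 2] Cube n) : IsBent fun x => F (A x) := fun y => by
  obtain ⟨y', hy'⟩ := exists_walsh_comp_linearEquiv A F y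
  rw [hy']
  exact hF y'

lemma isBentFace_of_isHyperplaneRestriction {m : ℕ} {f : BoolFun m} {F : BoolFun (m + 1)}
    (hF : IsBent F) (h : IsHyperplaneRestriction f F) : IsBentFace f := by
  obtain ⟨Γ, hΓ, e, he⟩ := h
  obtain ⟨w, hw⟩ : ∃ w, w ∉ Γ := by
    by_contra! hcon
    have htop : Γ = ⊤ := (Submodule.eq_top_iff').2 hcon
    rw [htop, finrank_top, Module.finrank_fin_fun] at hΓ
    omega
  let T : Cube (m + 1) →ₗ[ZMod 2] Cube m := LinearMap.funLeft (ZMod 2) (ZMod 2) Fin.succ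
  -- The identification e is extended to an automorphism of the whole cube by sending the first
  -- basis vector to w, outside Γ.
  let A : Cube (m + 1) →ₗ[ZMod 2] Cube (m + 1) :=
    Γ.subtype ∘ₗ e.toLinearMap ∘ₗ T + (LinearMap.proj (0 : Fin (m + 1))).smulRight w
  have hA : ∀ z, A z = (e (T z) : Cube (m + 1)) + z 0 • w := fun z => rfl
  have hinj : Function.Injective A := by
    rw [injective_iff_map_eq_zero]
    intro z hz
    rw [hA] at hz
    have hz0 : z 0 = 0 := by
      rcases zmod_two_cases (z 0) with h0 | h0
      · exact h0
      · rw [h0, one_smul] at hz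
        exact absurd (cube_add_eq_zero.1 hz ▸ (e (T z)).2) hw
    rw [hz0, zero_smul, add_zero] at hz
    have hT : T z = 0 := by simpa using hz
    funext i
    refine Fin.cases hz0 (fun i => ?_) i
    exact congrFun hT i
  refine ⟨_, hF.comp_linearEquiv (LinearEquiv.ofInjectiveEndo A hinj), fun x => ?_⟩
  have hT : T (Matrix.vecCons 0 x) = x := by
    funext i; simp [T, LinearMap.funLeft]
  rw [he x, LinearEquiv.coe_ofInjectiveEndo, hA, hT]
  simp

lemma isHyperplaneRestriction_vecCons {m : ℕ} (F : BoolFun (m + 1)) :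
    IsHyperplaneRestriction (fun x => F (Matrix.vecCons 0 x)) F := by
  let φ : Cube m →ₗ[ZMod 2] Cube (m + 1) :=
    { toFun := fun x => Matrix.vecCons 0 x
      map_add' := fun x y => by simp
      map_smul' := fun c x => by simp }
  have hφ : Function.Injective φ := fun x y h => (Matrix.vecCons_inj.1 h).2
  refine ⟨LinearMap.range φ, ?_, LinearEquiv.ofInjective φ hφ, fun x => rfl⟩
  rw [LinearMap.finrank_range_of_inj hφ, Module.finrank_fin_fun]

/-- The Walsh transform of the restriction to a coordinate hyperplane, through the dual. -/
lemma walsh_face {h m : ℕ} {F G : BoolFun (m + 1)} {f : BoolFun m}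
    (hG : ∀ y, walsh F y = 2 ^ h * sgn (G y)) (hf : ∀ x, f x = F (Matrix.vecCons 0 x))
    (y : Cube m) :
    2 * walsh f y = 2 ^ h * (sgn (G (Matrix.vecCons 0 y)) + sgn (G (Matrix.vecCons 1 y))) := by
  have h0 := walsh_vecCons F 0 y
  have h1 := walsh_vecCons F 1 y
  rw [hG] at h0 h1
  have hff : f = fun x => F (Matrix.vecCons 0 x) := funext hf
  rw [← hff] at h0 h1
  simp only [sgn_zero, sgn_one] at h0 h1
  linear_combination -h0 - h1

/-- Averaging the two signs of the dual above y yields their common value or 0, so f reveals the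
dual except at the zeros of its transform, where the two bits are complementary. -/
lemma walsh_face_cases {h m : ℕ} {F G : BoolFun (m + 1)} {f : BoolFun m}
    (hG : ∀ y, walsh F y = 2 ^ h * sgn (G y)) (hf : ∀ x, f x = F (Matrix.vecCons 0 x))
    (y : Cube m) :
    (G (Matrix.vecCons 0 y) = G (Matrix.vecCons 1 y) ∧
      walsh f y = 2 ^ h * sgn (G (Matrix.vecCons 0 y))) ∨
    (G (Matrix.vecCons 1 y) = G (Matrix.vecCons 0 y) + 1 ∧ walsh f y = 0) := by
  have hw := walsh_face hG hf y
  rcases zmod_two_cases (G (Matrix.vecCons 0 y)) with h0 | h0 <;>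
    rcases zmod_two_cases (G (Matrix.vecCons 1 y)) with h1 | h1 <;> rw [h0, h1] at hw ⊢
  · left; exact ⟨rfl, by linear_combination hw / 2⟩
  · right; exact ⟨rfl, by simpa using hw⟩
  · right; exact ⟨rfl, by simpa using hw⟩
  · left; exact ⟨rfl, by linear_combination hw / 2⟩

lemma isPlateaued_of_isBentFace {h m : ℕ} (hm : m + 1 = 2 * h) {f : BoolFun m}
    (hf : IsBentFace f) : IsPlateaued 1 f := by
  obtain ⟨F, hF, hfF⟩ := hf
  obtain ⟨G, hG⟩ := (isBent_iff hm F).1 hF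
  have hp : (2 : ℝ) ^ (((m : ℝ) + ((1 : ℕ) : ℝ)) / 2) = 2 ^ h := by
    have : (m : ℝ) + 1 = 2 * h := by exact_mod_cast hm
    rw [← Real.rpow_natCast, Nat.cast_one, this]; congr 1; ring
  intro y
  rw [hp]
  rcases walsh_face_cases hG hfF y with ⟨_, h1⟩ | ⟨_, h1⟩
  · rw [h1]
    rcases sgn_eq_or (G (Matrix.vecCons 0 y)) with h2 | h2 <;> simp [h2]
  · simp [h1]

/-- The Walsh transform of a bent restriction vanishes on exactly half of the cube. -/
lemma two_mul_card_walsh_eq_zero {h m : ℕ} (hm : m + 1 = 2 * h) {f : BoolFun m}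
    (hf : IsBentFace f) :
    2 * (Finset.univ.filter fun y => walsh f y = 0).card = 2 ^ m := by
  classical
  obtain ⟨F, hF, hfF⟩ := hf
  obtain ⟨G, hG⟩ := (isBent_iff hm F).1 hF
  have h1 : ∀ y, walsh f y ^ 2 = 2 ^ (2 * h) - 2 ^ (2 * h) * if walsh f y = 0 then 1 else 0 := by
    intro y
    rcases walsh_face_cases hG hfF y with ⟨_, h2⟩ | ⟨_, h2⟩
    · have h3 : walsh f y ≠ 0 := by rw [h2]; exact mul_ne_zero (by positivity) (sgn_ne_zero _)
      rw [if_neg h3, h2]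
      linear_combination (2 ^ h * 2 ^ h) * sgn_mul_self (G (Matrix.vecCons 0 y))
    · simp [h2]
  have h2 := sum_walsh_sq f
  simp_rw [h1] at h2
  rw [Finset.sum_sub_distrib, ← Finset.mul_sum, Finset.sum_boole, Finset.sum_const,
    Finset.card_univ, card_cube, ← hm] at h2
  have h3 : (2 : ℝ) * ((Finset.univ.filter fun y => walsh f y = 0).card : ℝ) = 2 ^ m := by
    have h4 : (2 : ℝ) ^ m ≠ 0 := by positivity
    have h5 : (2 : ℝ) ^ m * (2 ^ m - 2 * ((Finset.univ.filter fun y => walsh f y = 0).card : ℝ)) = 0 := by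
      rw [nsmul_eq_mul] at h2; push_cast at h2; rw [pow_succ] at h2; linear_combination h2
    rcases mul_eq_zero.1 h5 with h6 | h6
    · exact absurd h6 h4
    · linear_combination -h6
  exact_mod_cast h3

/-- The number of bent functions with a given restriction to a coordinate hyperplane. -/
lemma card_bent_extensions_le {h m : ℕ} (hm : m + 1 = 2 * h) (h2 : 2 ≤ h) (f : BoolFun m)
    (s : Finset (BoolFun (m + 1)))
    (hs : ∀ F ∈ s, IsBent F ∧ ∀ x, f x = F (Matrix.vecCons 0 x)) :
    s.card ≤ 2 ^ ((hball m h).card / 2) := by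
  classical
  rcases s.eq_empty_or_nonempty with rfl | ⟨F₀, hF₀⟩
  · simp
  have hcard := two_mul_card_walsh_eq_zero hm ⟨F₀, hs F₀ hF₀⟩
  -- The ball is translated so that at most half of it consists of zeros of the transform, the only
  -- points where the dual is not yet known.
  obtain ⟨τ, hτ⟩ := exists_translate_sum_le h fun y : Cube m => if walsh f y = 0 then 1 else 0
  rw [← Finset.card_filter, ← Finset.card_filter] at hτ
  set J := (hball m h).filter fun x => walsh f (x + τ) = 0
  have hJ : J.card ≤ (hball m h).card / 2 := by
    have hpos : 0 < 2 ^ m := by positivity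
    rw [Nat.le_div_iff_mul_le (by norm_num)]
    refine Nat.le_of_mul_le_mul_left ?_ hpos
    nlinarith
  have hex : ∀ F : BoolFun (m + 1), F ∈ s → ∃ G : BoolFun (m + 1),
      ∀ y, walsh F y = 2 ^ h * sgn (G y) := fun F hF => (isBent_iff hm F).1 (hs F hF).1
  choose! D hD using hex
  refine le_trans ?_ (Nat.pow_le_pow_right (by norm_num) hJ)
  have hle : s.card ≤ Fintype.card (J → ZMod 2) := by
    rw [← Finset.card_univ]
    refine Finset.card_le_card_of_injOn (fun F x => D F (Matrix.vecCons 0 (x.1 + τ)))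
      (fun _ _ => Finset.mem_coe.2 (Finset.mem_univ _)) ?_
    intro F hF F' hF' heq
    have hlow : ∀ K ∈ s, LowDeg h fun y => D K (Matrix.vecCons 0 y) := fun K hK =>
      (lowDeg_of_bent hm h2 (walsh_dual hm (hD K hK))).vecCons 0
    have h0 : (fun y => D F (Matrix.vecCons 0 y)) = fun y => D F' (Matrix.vecCons 0 y) := by
      refine (hlow F hF).ext (hlow F' hF') τ fun x hx => ?_
      by_cases hw : walsh f (x + τ) = 0
      · exact congrFun heq ⟨x, Finset.mem_filter.2 ⟨hx, hw⟩⟩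
      · rcases walsh_face_cases (hD F hF) (hs F hF).2 (x + τ) with ⟨_, h3⟩ | ⟨_, h3⟩
        · rcases walsh_face_cases (hD F' hF') (hs F' hF').2 (x + τ) with ⟨_, h4⟩ | ⟨_, h4⟩
          · rw [h3] at h4
            exact sgn_injective (mul_left_cancel₀ (by positivity) h4)
          · exact absurd h4 hw
        · exact absurd h3 hw
    -- The transform of f fixes the sum of the two signs above y, so the upper half of the dual
    -- follows from the lower half.
    have hsgn : ∀ y, sgn (D F (Matrix.vecCons 1 y)) = sgn (D F' (Matrix.vecCons 1 y)) := by
      intro y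
      have h3 := walsh_face (hD F hF) (hs F hF).2 y
      rw [walsh_face (hD F' hF') (hs F' hF').2 y] at h3
      have h4 := mul_left_cancel₀ (by positivity) h3
      rw [congrFun h0 y] at h4
      linarith
    refine walsh_injective fun y => ?_
    rw [hD F hF, hD F' hF', ← Matrix.cons_head_tail y]
    rcases zmod_two_cases (Matrix.vecHead y) with h3 | h3 <;> rw [h3]
    · rw [congrFun h0 (Matrix.vecTail y)]
    · rw [hsgn]
  simpa [ZMod.card] using hle

/-- Comparison of the number of bent functions with that of their restrictions. -/
lemma card_bent_le {h m : ℕ} (hm : m + 1 = 2 * h) (h2 : 2 ≤ h) :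
    Nat.card {F : BoolFun (m + 1) // IsBent F} ≤
      2 ^ ((hball m h).card / 2) * Nat.card {f : BoolFun m // IsPlateaued 1 f ∧
        ∃ F : BoolFun (m + 1), IsBent F ∧ IsHyperplaneRestriction f F} := by
  classical
  rw [Nat.card_eq_fintype_card, Nat.card_eq_fintype_card, Fintype.card_subtype,
    Fintype.card_subtype]
  refine le_trans (Finset.card_le_mul_card_image (f := fun (F : BoolFun (m + 1)) (x : Cube m) =>
    F (Matrix.vecCons 0 x)) _ (2 ^ ((hball m h).card / 2)) ?_)
    (Nat.mul_le_mul_left _ (Finset.card_le_card ?_))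
  · intro f _
    refine card_bent_extensions_le hm h2 f _ fun F hF => ?_
    simp only [Finset.mem_filter, Finset.mem_univ, true_and] at hF
    exact ⟨hF.1, fun x => (congrFun hF.2 x).symm⟩
  · intro f hf
    simp only [Finset.mem_image, Finset.mem_filter, Finset.mem_univ, true_and] at hf ⊢
    obtain ⟨F, hF, rfl⟩ := hf
    exact ⟨isPlateaued_of_isBentFace hm ⟨F, hF, fun _ => rfl⟩, F, hF,
      isHyperplaneRestriction_vecCons F⟩

/-! ### Shears -/

/-- Allows a substitution to be carried past an inert first coordinate. It serves twice: to place
the shear behind the second plane coordinate, and to lift it to a bent extension. -/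
lemma walsh_lift {n : ℕ} {S S' : Cube n → Cube n}
    (hS : ∀ (g : BoolFun n) y, walsh (fun x => g (S x)) y = walsh g (S' y))
    (f : BoolFun (n + 1)) (c : ZMod 2) (y : Cube n) :
    walsh (fun x => f (Matrix.vecCons (Matrix.vecHead x) (S (Matrix.vecTail x))))
      (Matrix.vecCons c y) = walsh f (Matrix.vecCons c (S' y)) := by
  rw [walsh_vecCons, walsh_vecCons]
  simp only [Matrix.head_cons, Matrix.tail_cons]
  rw [hS (fun x => f (Matrix.vecCons 0 x)), hS (fun x => f (Matrix.vecCons 1 x))]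

/-- The shear `(c, x) ↦ (c + ⟨b, x⟩, x)`. -/
def shear {n : ℕ} (b : Cube n) (x : Cube (n + 1)) : Cube (n + 1) :=
  Matrix.vecCons (Matrix.vecHead x + b ⬝ᵥ Matrix.vecTail x) (Matrix.vecTail x)

/-- The action of a shear on frequencies. -/
def coshear {n : ℕ} (b : Cube n) (y : Cube (n + 1)) : Cube (n + 1) :=
  Matrix.vecCons (Matrix.vecHead y) (Matrix.vecTail y + Matrix.vecHead y • b)

lemma shear_shear {n : ℕ} (b : Cube n) (x : Cube (n + 1)) : shear b (shear b x) = x := by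
  simp only [shear, Matrix.head_cons, Matrix.tail_cons, add_assoc, CharTwo.add_self_eq_zero,
    add_zero]
  exact Matrix.cons_head_tail x

lemma walsh_shear {n : ℕ} (b : Cube n) (g : BoolFun (n + 1)) (y : Cube (n + 1)) :
    walsh (fun x => g (shear b x)) y = walsh g (coshear b y) := by
  rw [← Matrix.cons_head_tail y]
  generalize Matrix.vecHead y = c
  generalize Matrix.vecTail y = z
  simp only [coshear, Matrix.head_cons, Matrix.tail_cons]
  rw [walsh_vecCons, walsh_vecCons]
  simp only [walsh_eq, shear, Matrix.head_cons, Matrix.tail_cons, Finset.mul_sum]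
  rw [← Finset.sum_add_distrib, ← Finset.sum_add_distrib]
  refine Finset.sum_congr rfl fun x _ => ?_
  rw [dotProduct_add, dotProduct_smul, dotProduct_comm x b, sgn_add (x ⬝ᵥ z)]
  rcases zmod_two_cases c with rfl | rfl <;> rcases zmod_two_cases (b ⬝ᵥ x) with h | h <;>
    simp [h, show (1 + 1 : ZMod 2) = 0 from rfl] <;> ring

/-- The shear acting on the last coordinates. -/
def shearSnd {n : ℕ} (b : Cube n) (x : Cube (n + 2)) : Cube (n + 2) :=
  Matrix.vecCons (Matrix.vecHead x) (shear b (Matrix.vecTail x))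

lemma shearSnd_shearSnd {n : ℕ} (b : Cube n) (x : Cube (n + 2)) :
    shearSnd b (shearSnd b x) = x := by
  simp only [shearSnd, Matrix.head_cons, Matrix.tail_cons, shear_shear]
  exact Matrix.cons_head_tail x

lemma walsh_shearSnd {n : ℕ} (b : Cube n) (f : BoolFun (n + 2)) (y : Cube (n + 2)) :
    walsh (fun x => f (shearSnd b x)) y =
      walsh f (Matrix.vecCons (Matrix.vecHead y) (coshear b (Matrix.vecTail y))) := by
  conv_lhs => rw [← Matrix.cons_head_tail y]
  exact walsh_lift (walsh_shear b) f _ _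

lemma walsh_shearSnd_cons {n : ℕ} (b : Cube n) (f : BoolFun (n + 2)) (c d : ZMod 2) (y : Cube n) :
    walsh (fun x => f (shearSnd b x)) (Matrix.vecCons c (Matrix.vecCons d y)) =
      walsh f (Matrix.vecCons c (Matrix.vecCons d (y + d • b))) := by
  rw [walsh_shearSnd]; rfl

lemma IsBentFace.shearSnd {n : ℕ} {f : BoolFun (n + 2)} (hf : IsBentFace f) (b : Cube n) :
    IsBentFace fun x => f (shearSnd b x) := by
  obtain ⟨F, hF, hfF⟩ := hf
  refine ⟨fun x => F (Matrix.vecCons (Matrix.vecHead x) (_root_.shearSnd b (Matrix.vecTail x))),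
    fun y => ?_, fun x => by simp [hfF]⟩
  rw [← Matrix.cons_head_tail y, walsh_lift (walsh_shearSnd b) F]
  exact hF _

/-- The product of the Walsh coefficients over a coset of the first coordinate plane. -/
noncomputable def planeProd {n : ℕ} (f : BoolFun (n + 2)) (y : Cube n) : ℝ :=
  walsh f (Matrix.vecCons 0 (Matrix.vecCons 0 y)) * walsh f (Matrix.vecCons 0 (Matrix.vecCons 1 y)) *
  walsh f (Matrix.vecCons 1 (Matrix.vecCons 0 y)) * walsh f (Matrix.vecCons 1 (Matrix.vecCons 1 y))

/-- The shear by b translates one of the two pair products D 0, D 1 against the other. Summing over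
all b gives (∑ D 0)(∑ D 1), and the two factors are opposite, so the average over b is nonpositive.
-/
lemma exists_shear_sum_planeProd_nonpos {n : ℕ} (f : BoolFun (n + 2)) :
    ∃ b : Cube n, ∑ y, planeProd (fun x => f (shearSnd b x)) y ≤ 0 := by
  let D : ZMod 2 → Cube n → ℝ := fun d y =>
    walsh f (Matrix.vecCons 0 (Matrix.vecCons d y)) * walsh f (Matrix.vecCons 1 (Matrix.vecCons d y))
  have h1 : ∀ b y, planeProd (fun x => f (shearSnd b x)) y = D 0 y * D 1 (y + b) := by
    intro b y
    simp only [planeProd, walsh_shearSnd_cons, D, zero_smul, add_zero, one_smul]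
    ring
  have hD : ∑ y, D 0 y + ∑ y, D 1 y = 0 := by
    -- The autocorrelation at the first basis vector vanishes, and it counts each pair product
    -- twice.
    have h2 := sum_walsh_mul_walsh_add f (Matrix.vecCons 1 0)
    rw [if_neg (fun h => by simpa using congrFun h 0), sum_vecCons, sum_vecCons,
      sum_vecCons] at h2
    simp only [Matrix.cons_add_cons, add_zero, zero_add, show (1 + 1 : ZMod 2) = 0 from rfl] at h2
    have h3 : ∀ d y, walsh f (Matrix.vecCons 1 (Matrix.vecCons d y)) *
      walsh f (Matrix.vecCons 0 (Matrix.vecCons d y)) = D d y := fun d y => mul_comm _ _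
    simp only [h3] at h2
    change ∑ y, D 0 y + ∑ y, D 1 y + (∑ y, D 0 y + ∑ y, D 1 y) = 0 at h2
    linarith
  have h2 : ∑ b : Cube n, ∑ y, planeProd (fun x => f (shearSnd b x)) y ≤ ∑ _b : Cube n, 0 := by
    simp_rw [h1]
    rw [Finset.sum_comm]
    simp_rw [← Finset.mul_sum]
    have h3 : ∀ y : Cube n, ∑ b, D 1 (y + b) = ∑ z, D 1 z := fun y =>
      Equiv.sum_comp (Equiv.addLeft y) (D 1)
    simp_rw [h3]
    rw [← Finset.sum_mul, Finset.sum_const_zero]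
    rw [show ∑ z, D 1 z = -∑ y, D 0 y by linarith]
    nlinarith [mul_self_nonneg (∑ y, D 0 y)]
  obtain ⟨b, _, hb⟩ := Finset.exists_le_of_sum_le Finset.univ_nonempty h2
  exact ⟨b, hb⟩

/-! ### Code lengths of sign patterns -/

/-- Twice the code length of the support bit for a pattern of four signs: zero if both signs
occur, otherwise depending on the number of nonzero entries. -/
def cost (a b c d : SignType) : ℕ :=
  if (0 ≤ a ∧ 0 ≤ b ∧ 0 ≤ c ∧ 0 ≤ d) ∨ (a ≤ 0 ∧ b ≤ 0 ∧ c ≤ 0 ∧ d ≤ 0) then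
    (if a * b * c ≠ 0 ∨ a * b * d ≠ 0 ∨ a * c * d ≠ 0 ∨ b * c * d ≠ 0 then 4
    else if a * b ≠ 0 ∨ a * c ≠ 0 ∨ a * d ≠ 0 ∨ b * c ≠ 0 ∨ b * d ≠ 0 ∨ c * d ≠ 0 then 2 else 1)
  else 0

/-- The four signs are equal and nonzero. -/
abbrev Unanimous (a b c d : SignType) : Prop := a ≠ 0 ∧ b = a ∧ c = a ∧ d = a

/-- Twice the code length, where the common sign of a unanimous pattern counts with weight two. -/
def totalCost (a b c d : SignType) : ℕ := cost a b c d + 4 * if Unanimous a b c d then 1 else 0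

-- The four terms are the twists by the characters of the plane. With 4, 3, 2, 1 or 0 nonzero signs,
-- the number of one-signed twists is 1 or 0 (according to the product), 1, 2, 4 and 4; the values
-- of `cost` are tuned to this.
set_option maxRecDepth 10000 in
lemma sum_totalCost : ∀ a b c d : SignType,
    ((totalCost a b c d + totalCost a (-b) c (-d) +
      (totalCost a b (-c) (-d) + totalCost a (-b) (-c) d) : ℕ) : ℤ) =
    4 + 4 * ((a * b * c * d : SignType) : ℤ) := by
  decide

-- With the zero status of the first entry fixed, a nonzero common shift must be ±2, which forces
-- all entries to be 1 in one pattern and -1 in the other.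
set_option maxRecDepth 10000 in
lemma eq_or_unanimous_of_sub_eq : ∀ a a' : SignType, (a = 0 ↔ a' = 0) →
    ∀ b b' : SignType, (b : ℤ) - b' = a - a' → ∀ c c' : SignType, (c : ℤ) - c' = a - a' →
    ∀ d d' : SignType, (d : ℤ) - d' = a - a' →
    (a' = a ∧ b' = b ∧ c' = c ∧ d' = d) ∨
    (Unanimous a b c d ∧ Unanimous a' b' c' d' ∧ cost a b c d = cost a' b' c' d' ∧ a ≠ a') := by
  decide

-- Here the shift is ±1, so neither pattern has both signs and the shift exchanges zero and nonzero
-- entries. The numbers of nonzero entries add up to 4, which leaves the Kraft-compatible cost pairs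
-- (1, 4), (2, 2), (4, 1).
set_option maxRecDepth 10000 in
lemma cost_of_sub_eq : ∀ a a' : SignType, ¬(a = 0 ↔ a' = 0) →
    ∀ b b' : SignType, (b : ℤ) - b' = a - a' → ∀ c c' : SignType, (c : ℤ) - c' = a - a' →
    ∀ d d' : SignType, (d : ℤ) - d' = a - a' →
    (1 ≤ cost a b c d ∧ 4 ≤ cost a' b' c' d') ∨ (2 ≤ cost a b c d ∧ 2 ≤ cost a' b' c' d') ∨
    (4 ≤ cost a b c d ∧ 1 ≤ cost a' b' c' d') := by
  decide

/-! ### Sign patterns of Walsh coefficients -/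

/-- The sign of a Walsh coefficient. -/
noncomputable def walshSign {n : ℕ} (f : BoolFun n) (y : Cube n) : SignType :=
  SignType.sign (walsh f y)

/-- The sign character of `ZMod 2` with values in `SignType`. -/
def signChar (a : ZMod 2) : SignType := if a = 0 then 1 else -1

lemma signChar_zero : signChar 0 = 1 := rfl

lemma signChar_one : signChar 1 = -1 := rfl

lemma coe_signChar (a : ZMod 2) : ((signChar a : SignType) : ℝ) = sgn a := by
  rcases zmod_two_cases a with rfl | rfl
  · simp [signChar_zero]
  · simp [signChar_one]

/-- The twisted sign pattern of `f` on a coset of the first coordinate plane. -/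
noncomputable def pat {n : ℕ} (f : BoolFun (n + 2)) (c d : ZMod 2) (y : Cube n) (p q : ZMod 2) :
    SignType :=
  signChar (c * p + d * q) * walshSign f (Matrix.vecCons p (Matrix.vecCons q y))

/-- `cost` of the twisted sign pattern. -/
noncomputable def patCost {n : ℕ} (f : BoolFun (n + 2)) (c d : ZMod 2) (y : Cube n) : ℕ :=
  cost (pat f c d y 0 0) (pat f c d y 0 1) (pat f c d y 1 0) (pat f c d y 1 1)

/-- The twisted sign pattern is constant and nonzero. -/
def PatUnanimous {n : ℕ} (f : BoolFun (n + 2)) (c d : ZMod 2) (y : Cube n) : Prop :=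
  Unanimous (pat f c d y 0 0) (pat f c d y 0 1) (pat f c d y 1 0) (pat f c d y 1 1)

/-- The support of the Walsh transform on the section of the cosets of the first coordinate
plane. -/
noncomputable def suppBit {n : ℕ} (f : BoolFun (n + 2)) (y : Cube n) : ZMod 2 :=
  if walshSign f (Matrix.vecCons 0 (Matrix.vecCons 0 y)) = 0 then 0 else 1

lemma pat_zero_zero {n : ℕ} (f : BoolFun (n + 2)) (c d : ZMod 2) (y : Cube n) :
    pat f c d y 0 0 = walshSign f (Matrix.vecCons 0 (Matrix.vecCons 0 y)) := by
  simp [pat, signChar]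

lemma suppBit_eq_iff {n : ℕ} (f g : BoolFun (n + 2)) (c d : ZMod 2) (y : Cube n) :
    suppBit f y = suppBit g y ↔ (pat f c d y 0 0 = 0 ↔ pat g c d y 0 0 = 0) := by
  rw [pat_zero_zero, pat_zero_zero, suppBit, suppBit]
  split_ifs <;> simp_all

lemma walshSign_eq_of_pat_eq {n : ℕ} {f g : BoolFun (n + 2)} {c d : ZMod 2} {y : Cube n}
    {p q : ZMod 2} (h : pat f c d y p q = pat g c d y p q) :
    walshSign f (Matrix.vecCons p (Matrix.vecCons q y)) =
      walshSign g (Matrix.vecCons p (Matrix.vecCons q y)) := by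
  unfold pat at h
  rcases zmod_two_cases (c * p + d * q) with h0 | h0 <;> rw [h0] at h
  · simpa [signChar_zero] using h
  · rw [signChar_one] at h
    generalize walshSign f _ = a at h ⊢
    generalize walshSign g _ = b at h ⊢
    revert a b; decide

/-- The Walsh coefficients are `0` or `± 2 ^ h`. -/
def Ternary {n : ℕ} (h : ℕ) (f : BoolFun n) : Prop := ∀ y, walsh f y = 2 ^ h * (walshSign f y : ℝ)

lemma IsBentFace.ternary {h m : ℕ} (hm : m + 1 = 2 * h) {f : BoolFun m} (hf : IsBentFace f) :
    Ternary h f := by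
  obtain ⟨F, hF, hfF⟩ := hf
  obtain ⟨G, hG⟩ := (isBent_iff hm F).1 hF
  intro y
  have hpos : (0 : ℝ) < 2 ^ h := by positivity
  unfold walshSign
  rcases walsh_face_cases hG hfF y with ⟨_, h1⟩ | ⟨_, h1⟩
  · rw [h1]
    rcases sgn_eq_or (G (Matrix.vecCons 0 y)) with h2 | h2 <;> rw [h2]
    · simp [hpos]
    · simp [hpos]
  · simp [h1]

lemma Ternary.eq_of_walshSign_eq {n h : ℕ} {f g : BoolFun n} (hf : Ternary h f) (hg : Ternary h g)
    (hfg : ∀ y, walshSign f y = walshSign g y) : f = g :=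
  walsh_injective fun y => by rw [hf, hg, hfg]

/-- The support bit is 1 plus the two values of the dual G above the frequency, and G is itself
bent, hence of degree at most h. -/
lemma IsBentFace.lowDeg_suppBit {h n : ℕ} (hn : n + 2 + 1 = 2 * h) (h2 : 2 ≤ h)
    {f : BoolFun (n + 2)} (hf : IsBentFace f) : LowDeg h (suppBit f) := by
  obtain ⟨F, hF, hfF⟩ := hf
  obtain ⟨G, hG⟩ := (isBent_iff hn F).1 hF
  have hl := lowDeg_of_bent hn h2 (walsh_dual hn hG)
  have h3 := ((lowDeg_const h 1).add (((hl.vecCons 0).vecCons 0).vecCons 0)).add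
    (((hl.vecCons 1).vecCons 0).vecCons 0)
  convert h3 using 2 with y
  unfold suppBit walshSign
  rcases walsh_face_cases hG hfF (Matrix.vecCons 0 (Matrix.vecCons 0 y)) with ⟨h4, h5⟩ | ⟨h4, h5⟩
  · have h6 : walsh f (Matrix.vecCons 0 (Matrix.vecCons 0 y)) ≠ 0 := by
      rw [h5]; exact mul_ne_zero (by positivity) (sgn_ne_zero _)
    rw [if_neg (by simpa using h6), h4, add_assoc, CharTwo.add_self_eq_zero, add_zero]
  · rw [h5, h4]
    rcases zmod_two_cases (G (Matrix.vecCons 0 (Matrix.vecCons 0 (Matrix.vecCons 0 y)))) with h6 | h6 <;>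
      rw [h6] <;> simp [show (1 + 1 : ZMod 2) = 0 from rfl]

lemma IsBentFace.lowDeg {h m : ℕ} (hm : m + 1 = 2 * h) (h2 : 2 ≤ h) {f : BoolFun m}
    (hf : IsBentFace f) : LowDeg h f := by
  obtain ⟨F, hF, hfF⟩ := hf
  obtain ⟨G, hG⟩ := (isBent_iff hm F).1 hF
  have h3 := (lowDeg_of_bent hm h2 hG).vecCons 0
  convert h3 using 1
  exact funext hfF

/-- The restriction of `f` to a coset of the subspace where the first two coordinates vanish. -/
def coset {n : ℕ} (f : BoolFun (n + 2)) (p q : ZMod 2) : BoolFun n :=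
  fun x => f (Matrix.vecCons p (Matrix.vecCons q x))

lemma walsh_eq_sum_coset {n : ℕ} (f : BoolFun (n + 2)) (p q : ZMod 2) (y : Cube n) :
    walsh f (Matrix.vecCons p (Matrix.vecCons q y)) =
      walsh (coset f 0 0) y + sgn q * walsh (coset f 0 1) y +
      sgn p * (walsh (coset f 1 0) y + sgn q * walsh (coset f 1 1) y) := by
  rw [walsh_vecCons, walsh_vecCons, walsh_vecCons]; rfl

/-- If two functions agree outside a coset, then their twisted sign patterns differ by constants. -/
lemma pat_sub_pat {n h : ℕ} {f g : BoolFun (n + 2)} (hf : Ternary h f) (hg : Ternary h g)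
    {c d : ZMod 2} (hfg : ∀ p q, (p, q) ≠ (c, d) → coset f p q = coset g p q)
    (y : Cube n) (p q : ZMod 2) :
    (pat f c d y p q : ℤ) - pat g c d y p q = pat f c d y 0 0 - pat g c d y 0 0 := by
  have key : ∀ p q : ZMod 2, (2 : ℝ) ^ h * ((pat f c d y p q : ℝ) - (pat g c d y p q : ℝ)) =
      walsh (coset f c d) y - walsh (coset g c d) y := by
    intro p q
    have h1 : (2 : ℝ) ^ h * ((pat f c d y p q : ℝ) - (pat g c d y p q : ℝ)) =
        sgn (c * p + d * q) * (walsh f (Matrix.vecCons p (Matrix.vecCons q y)) -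
          walsh g (Matrix.vecCons p (Matrix.vecCons q y))) := by
      rw [hf, hg, pat, pat, SignType.coe_mul, SignType.coe_mul, coe_signChar]; ring
    rw [h1, walsh_eq_sum_coset, walsh_eq_sum_coset g]
    have e : ∀ p q, (p, q) ≠ (c, d) → walsh (coset f p q) y = walsh (coset g p q) y :=
      fun p q hpq => by rw [hfg p q hpq]
    have hp := sgn_mul_self p
    have hq := sgn_mul_self q
    rcases zmod_two_cases c with rfl | rfl <;> rcases zmod_two_cases d with rfl | rfl
    · rw [e 0 1 (by decide), e 1 0 (by decide), e 1 1 (by decide)]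
      simp
    · rw [e 0 0 (by decide), e 1 0 (by decide), e 1 1 (by decide)]
      simp only [zero_mul, one_mul, zero_add]
      linear_combination (walsh (coset f 0 1) y - walsh (coset g 0 1) y) * hq
    · rw [e 0 0 (by decide), e 0 1 (by decide), e 1 1 (by decide)]
      simp only [zero_mul, one_mul, add_zero]
      linear_combination (walsh (coset f 1 0) y - walsh (coset g 1 0) y) * hp
    · rw [e 0 0 (by decide), e 0 1 (by decide), e 1 0 (by decide)]
      simp only [one_mul, sgn_add]
      linear_combination (walsh (coset f 1 1) y - walsh (coset g 1 1) y) * (sgn q * sgn q * hp + hq)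
  have h2 := mul_left_cancel₀ (by positivity) ((key p q).trans (key 0 0).symm)
  have h3 : (((pat f c d y p q : ℤ) - pat g c d y p q : ℤ) : ℝ) =
      ((pat f c d y 0 0 - pat g c d y 0 0 : ℤ) : ℝ) := by
    push_cast [SignType.intCast_cast]
    exact h2
  exact_mod_cast h3

/-! ### Counting functions with a given restriction to three cosets -/

/-- A Kraft inequality: symbols with subprobability weights, followed by a tail of bits whose number
depends only on the symbols. -/
lemma sum_kraft_le_one {ι α : Type*} [Fintype ι] [DecidableEq ι] (s : Finset α)
    (p : α → ι → ZMod 2) (w : ι → ZMod 2 → ℝ) (hw0 : ∀ i a, 0 ≤ w i a)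
    (hw1 : ∀ i, w i 0 + w i 1 ≤ 1) (k : α → ℕ)
    (hk : ∀ f ∈ s, (s.filter fun g => p g = p f).card ≤ 2 ^ k f)
    (hkp : ∀ f ∈ s, ∀ g ∈ s, p g = p f → k g = k f) :
    ∑ f ∈ s, (∏ i, w i (p f i)) * (1 / 2 : ℝ) ^ k f ≤ 1 := by
  classical
  have h1 : ∏ i, ∑ a ∈ (Finset.univ : Finset (ZMod 2)), w i a ≤ 1 := by
    refine Finset.prod_le_one (fun i _ => Finset.sum_nonneg fun a _ => hw0 i a) fun i _ => ?_
    have : ∑ a : ZMod 2, w i a = w i 0 + w i 1 := Fin.sum_univ_two (fun a : ZMod 2 => w i a)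
    rw [this]; exact hw1 i
  rw [Finset.prod_univ_sum, Fintype.piFinset_univ] at h1
  refine le_trans ?_ h1
  rw [← Finset.sum_fiberwise_of_maps_to (g := p) (t := Finset.univ) (fun _ _ => Finset.mem_univ _)]
  refine Finset.sum_le_sum fun x _ => ?_
  have hx0 : 0 ≤ ∏ i, w i (x i) := Finset.prod_nonneg fun i _ => hw0 i _
  rcases (s.filter fun g => p g = x).eq_empty_or_nonempty with he | ⟨f, hf⟩
  · rw [he]; simpa using hx0
  · rw [Finset.mem_filter] at hf
    obtain ⟨hfs, rfl⟩ := hf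
    have h2 : ∀ g ∈ s.filter (fun g => p g = p f), (∏ i, w i (p g i)) * (1 / 2 : ℝ) ^ k g =
        (∏ i, w i (p f i)) * (1 / 2 : ℝ) ^ k f := by
      intro g hg
      rw [Finset.mem_filter] at hg
      rw [hg.2, hkp f hfs g hg.1 hg.2]
    rw [Finset.sum_congr rfl h2, Finset.sum_const, nsmul_eq_mul]
    have h3 : ((s.filter fun g => p g = p f).card : ℝ) ≤ 2 ^ k f := by exact_mod_cast hk f hfs
    have h4 : ((s.filter fun g => p g = p f).card : ℝ) * (1 / 2 : ℝ) ^ k f ≤ 1 := by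
      calc _ ≤ (2 : ℝ) ^ k f * (1 / 2 : ℝ) ^ k f := by gcongr
        _ = 1 := by rw [← mul_pow]; norm_num
    nlinarith

/-- The restrictions of bent functions whose code length relative to the coset `(c, d)` and the
translate `τ` of the Hamming ball is at most half the size of that ball. -/
def CheapFace {n : ℕ} (h : ℕ) (c d : ZMod 2) (τ : Cube n) (f : BoolFun (n + 2)) : Prop :=
  IsBentFace f ∧ ∑ x ∈ hball n h, patCost f c d (x + τ) +
    2 * Nat.card {y : Cube n // PatUnanimous f c d y} ≤ (hball n h).card

section Fiber

variable {n h : ℕ} {c d : ZMod 2} {τ : Cube n} {f g : BoolFun (n + 2)}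

lemma pat_eq_or_unanimous (hf : Ternary h f) (hg : Ternary h g)
    (hfg : ∀ p q, (p, q) ≠ (c, d) → coset f p q = coset g p q) {y : Cube n}
    (hu : suppBit f y = suppBit g y) :
    (∀ p q, pat f c d y p q = pat g c d y p q) ∨ (PatUnanimous f c d y ∧ PatUnanimous g c d y ∧
      patCost f c d y = patCost g c d y ∧ pat f c d y 0 0 ≠ pat g c d y 0 0) := by
  have hs := pat_sub_pat hf hg hfg y
  rcases eq_or_unanimous_of_sub_eq _ _ ((suppBit_eq_iff f g c d y).1 hu) _ _ (hs 0 1) _ _ (hs 1 0)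
    _ _ (hs 1 1) with ⟨h1, h2, h3, h4⟩ | h1
  · left
    intro p q
    rcases zmod_two_cases p with rfl | rfl <;> rcases zmod_two_cases q with rfl | rfl
    exacts [h1.symm, h2.symm, h3.symm, h4.symm]
  · exact Or.inr h1

lemma patCost_eq (hf : Ternary h f) (hg : Ternary h g)
    (hfg : ∀ p q, (p, q) ≠ (c, d) → coset f p q = coset g p q) {y : Cube n}
    (hu : suppBit f y = suppBit g y) : patCost f c d y = patCost g c d y := by
  rcases pat_eq_or_unanimous hf hg hfg hu with h1 | h1
  · simp only [patCost, h1]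
  · exact h1.2.2.1

lemma patUnanimous_iff (hf : Ternary h f) (hg : Ternary h g)
    (hfg : ∀ p q, (p, q) ≠ (c, d) → coset f p q = coset g p q) {y : Cube n}
    (hu : suppBit f y = suppBit g y) : PatUnanimous f c d y ↔ PatUnanimous g c d y := by
  rcases pat_eq_or_unanimous hf hg hfg hu with h1 | h1
  · simp only [PatUnanimous, h1]
  · exact iff_of_true h1.1 h1.2.1

lemma patCost_cases (hf : Ternary h f) (hg : Ternary h g)
    (hfg : ∀ p q, (p, q) ≠ (c, d) → coset f p q = coset g p q) {y : Cube n}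
    (hu : suppBit f y ≠ suppBit g y) :
    (1 ≤ patCost f c d y ∧ 4 ≤ patCost g c d y) ∨ (2 ≤ patCost f c d y ∧ 2 ≤ patCost g c d y) ∨
    (4 ≤ patCost f c d y ∧ 1 ≤ patCost g c d y) := by
  have hs := pat_sub_pat hf hg hfg y
  exact cost_of_sub_eq _ _ (fun h1 => hu ((suppBit_eq_iff f g c d y).2 h1)) _ _ (hs 0 1) _ _
    (hs 1 0) _ _ (hs 1 1)

/-- A symbol distribution on the support bit adapted to a family of functions agreeing outside a
coset. -/
lemma exists_symbol_weights (s : Finset (BoolFun (n + 2))) (hT : ∀ f ∈ s, Ternary h f)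
    (hs : ∀ f ∈ s, ∀ g ∈ s, ∀ p q, (p, q) ≠ (c, d) → coset f p q = coset g p q) (y : Cube n) :
    ∃ w : ZMod 2 → ℝ, (∀ a, 0 ≤ w a) ∧ w 0 + w 1 ≤ 1 ∧
      ∀ f ∈ s, w (suppBit f y) = √(1 / 2) ^ patCost f c d y := by
  classical
  have hθ0 : 0 ≤ √(1 / 2 : ℝ) := Real.sqrt_nonneg _
  have hθ1 : √(1 / 2 : ℝ) ≤ 1 := Real.sqrt_le_one.2 (by norm_num)
  have hθ2 : √(1 / 2 : ℝ) ^ 2 = 1 / 2 := Real.sq_sqrt (by norm_num)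
  have hθ4 : √(1 / 2 : ℝ) ^ 4 = 1 / 4 := by
    rw [show √(1 / 2 : ℝ) ^ 4 = (√(1 / 2 : ℝ) ^ 2) ^ 2 by ring, hθ2]; norm_num
  -- Precisely what the cost pair (1, 4) needs: 3/4 + 1/4 = 1.
  have hθ3 : √(1 / 2 : ℝ) ≤ 3 / 4 := by nlinarith
  have hpow : ∀ {a b : ℕ}, a ≤ b → √(1 / 2 : ℝ) ^ b ≤ √(1 / 2 : ℝ) ^ a := fun hab =>
    pow_le_pow_of_le_one hθ0 hθ1 hab
  -- Within the family the cost depends only on the support bit, so any representative will do; a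
  -- bit value that never occurs gets weight 0.
  let w : ZMod 2 → ℝ := fun a =>
    if H : ∃ f ∈ s, suppBit f y = a then √(1 / 2) ^ patCost H.choose c d y else 0
  have hw : ∀ f ∈ s, w (suppBit f y) = √(1 / 2) ^ patCost f c d y := by
    intro f hf
    have H : ∃ g ∈ s, suppBit g y = suppBit f y := ⟨f, hf, rfl⟩
    simp only [w]
    rw [dif_pos H]
    obtain ⟨h1, h2⟩ := H.choose_spec
    rw [patCost_eq (hT _ h1) (hT f hf) (hs _ h1 f hf) h2]
  refine ⟨w, fun a => ?_, ?_, hw⟩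
  · simp only [w]; split_ifs <;> positivity
  · by_cases H0 : ∃ f ∈ s, suppBit f y = 0
    · obtain ⟨f, hf, hf0⟩ := H0
      have hwf := hw f hf
      rw [hf0] at hwf
      by_cases H1 : ∃ g ∈ s, suppBit g y = 1
      · obtain ⟨g, hg, hg1⟩ := H1
        have hwg := hw g hg
        rw [hg1] at hwg
        rw [hwf, hwg]
        rcases patCost_cases (hT f hf) (hT g hg) (hs f hf g hg) (y := y)
          (by rw [hf0, hg1]; decide) with ⟨h1, h2⟩ | ⟨h1, h2⟩ | ⟨h1, h2⟩ <;>
        · have h3 := hpow h1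
          have h4 := hpow h2
          simp only [hθ2, hθ4, pow_one] at h3 h4
          linarith
      · have : w 1 = 0 := by simp only [w]; rw [dif_neg H1]
        rw [this, hwf, add_zero]
        exact pow_le_one₀ hθ0 hθ1
    · have h0 : w 0 = 0 := by simp only [w]; rw [dif_neg H0]
      rw [h0, zero_add]
      simp only [w]
      split_ifs
      · exact pow_le_one₀ hθ0 hθ1
      · norm_num

/-- Once the support bits are known, the only freedom left is the common sign at each y with a
constant nonzero pattern. -/
lemma card_sameSupp_le (s : Finset (BoolFun (n + 2))) (hT : ∀ f ∈ s, Ternary h f)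
    (hs : ∀ f ∈ s, ∀ g ∈ s, ∀ p q, (p, q) ≠ (c, d) → coset f p q = coset g p q)
    (hu : ∀ g ∈ s, suppBit g = suppBit f) (hf : f ∈ s) :
    s.card ≤ 2 ^ Nat.card {y : Cube n // PatUnanimous f c d y} := by
  classical
  have hle : s.card ≤ Fintype.card ({y : Cube n // PatUnanimous f c d y} → Bool) := by
    rw [← Finset.card_univ]
    refine Finset.card_le_card_of_injOn (fun g y => decide (pat g c d y.1 0 0 = 1))
      (fun _ _ => Finset.mem_coe.2 (Finset.mem_univ _)) ?_
    intro g hg g' hg' heq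
    refine (hT g hg).eq_of_walshSign_eq (hT g' hg') fun z => ?_
    rw [← Matrix.cons_head_tail z, ← Matrix.cons_head_tail (Matrix.vecTail z)]
    generalize Matrix.vecTail (Matrix.vecTail z) = y
    have hgg : suppBit g y = suppBit g' y := by rw [hu g hg, hu g' hg']
    rcases pat_eq_or_unanimous (hT g hg) (hT g' hg') (hs g hg g' hg') hgg with h1 | ⟨h1, h2, -, h3⟩
    · exact walshSign_eq_of_pat_eq (h1 _ _)
    · exfalso
      have hfy : PatUnanimous f c d y :=
        (patUnanimous_iff (hT g hg) (hT f hf) (hs g hg f hf) (by rw [hu g hg])).1 h1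
      have h4 := congrFun heq ⟨y, hfy⟩
      simp only [decide_eq_decide] at h4
      have h5 := h1.1
      have h6 := h2.1
      generalize pat g c d y 0 0 = a at *
      generalize pat g' c d y 0 0 = b at *
      revert a b; decide
  simpa [Nat.card_eq_fintype_card] using hle

/-- The number of cheap functions with prescribed restrictions to three cosets. -/
lemma card_cheapFace_fiber_le (hn : n + 2 + 1 = 2 * h) (h2 : 2 ≤ h)
    (s : Finset (BoolFun (n + 2))) (hC : ∀ f ∈ s, CheapFace h c d τ f)
    (hs : ∀ f ∈ s, ∀ g ∈ s, ∀ p q, (p, q) ≠ (c, d) → coset f p q = coset g p q) :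
    s.card ≤ Nat.sqrt (2 ^ (hball n h).card) := by
  classical
  have hT : ∀ f ∈ s, Ternary h f := fun f hf => (hC f hf).1.ternary hn
  choose w hw0 hw1 hw using exists_symbol_weights s hT hs
  set B := (hball n h).card
  have hsupp : ∀ f ∈ s, ∀ g ∈ s,
      ((fun x : hball n h => suppBit g (x.1 + τ)) = fun x : hball n h => suppBit f (x.1 + τ)) →
      suppBit g = suppBit f := by
    intro f hf g hg hfg
    exact ((hC g hg).1.lowDeg_suppBit hn h2).ext ((hC f hf).1.lowDeg_suppBit hn h2) τ
      fun x hx => congrFun hfg ⟨x, hx⟩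
  have kraft := sum_kraft_le_one s (fun f (x : hball n h) => suppBit f (x.1 + τ))
    (fun x => w (x.1 + τ)) (fun x => hw0 _) (fun x => hw1 _)
    (fun f => Nat.card {y : Cube n // PatUnanimous f c d y})
    (fun f hf => card_sameSupp_le _ (fun g hg => hT g (Finset.mem_filter.1 hg).1)
      (fun g hg g' hg' => hs g (Finset.mem_filter.1 hg).1 g' (Finset.mem_filter.1 hg').1)
      (fun g hg => hsupp f hf g (Finset.mem_filter.1 hg).1 (Finset.mem_filter.1 hg).2)
      (Finset.mem_filter.2 ⟨hf, rfl⟩))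
    (fun f hf g hg hfg => by
      have hu := hsupp f hf g hg hfg
      refine Nat.card_congr (Equiv.subtypeEquivRight fun y => ?_)
      exact patUnanimous_iff (hT g hg) (hT f hf) (hs g hg f hf) (by rw [hu]))
  have hθ0 : 0 ≤ √(1 / 2 : ℝ) := Real.sqrt_nonneg _
  have hθ1 : √(1 / 2 : ℝ) ≤ 1 := Real.sqrt_le_one.2 (by norm_num)
  have hθ2 : √(1 / 2 : ℝ) ^ 2 = 1 / 2 := Real.sq_sqrt (by norm_num)
  have hterm : ∀ f ∈ s, √(1 / 2 : ℝ) ^ B ≤ (∏ x : hball n h, w (x.1 + τ) (suppBit f (x.1 + τ))) *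
      (1 / 2 : ℝ) ^ Nat.card {y : Cube n // PatUnanimous f c d y} := by
    intro f hf
    have h3 : ∀ x : hball n h, w (x.1 + τ) (suppBit f (x.1 + τ)) =
      √(1 / 2) ^ patCost f c d (x.1 + τ) := fun x => hw _ f hf
    have h4 : ∀ k : ℕ, (1 / 2 : ℝ) ^ k = √(1 / 2) ^ (2 * k) := fun k => by rw [pow_mul, hθ2]
    rw [Finset.prod_congr rfl (fun x _ => h3 x), Finset.prod_pow_eq_pow_sum,
      Finset.sum_coe_sort (hball n h) (fun x => patCost f c d (x + τ)), h4, ← pow_add]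
    exact pow_le_pow_of_le_one hθ0 hθ1 (hC f hf).2
  -- Each member contributes at least 2^(-B/2) to a Kraft sum bounded by 1.
  have h3 := (Finset.sum_le_sum hterm).trans kraft
  rw [Finset.sum_const, nsmul_eq_mul] at h3
  rw [Nat.le_sqrt']
  have h4 : (s.card : ℝ) ^ 2 * (1 / 2) ^ B ≤ 1 := by
    have h5 : ((s.card : ℝ) * √(1 / 2 : ℝ) ^ B) ^ 2 ≤ 1 := pow_le_one₀ (by positivity) h3
    have h6 : (√(1 / 2 : ℝ) ^ B) ^ 2 = (1 / 2) ^ B := by rw [← pow_mul, mul_comm, pow_mul, hθ2]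
    rwa [mul_pow, h6] at h5
  have h5 : (s.card : ℝ) ^ 2 ≤ 2 ^ B := by
    have h6 : (1 / 2 : ℝ) ^ B * 2 ^ B = 1 := by rw [← mul_pow]; norm_num
    calc (s.card : ℝ) ^ 2 = (s.card : ℝ) ^ 2 * (1 / 2) ^ B * 2 ^ B := by rw [mul_assoc, h6, mul_one]
      _ ≤ 1 * 2 ^ B := by gcongr
      _ = 2 ^ B := one_mul _
  exact_mod_cast h5

end Fiber

/-- Three cosets carry arbitrary functions of degree at most h; the fourth is paid for at the cheap
rate. -/
lemma card_cheapFace_le {n h : ℕ} (hn : n + 2 + 1 = 2 * h) (h2 : 2 ≤ h) (c d : ZMod 2) (τ : Cube n)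
    (s : Finset (BoolFun (n + 2))) (hC : ∀ f ∈ s, CheapFace h c d τ f) :
    s.card ≤ Nat.sqrt (2 ^ (hball n h).card) * (2 ^ (hball n h).card) ^ 3 := by
  classical
  let Φ : BoolFun (n + 2) → ZMod 2 × ZMod 2 → BoolFun n := fun f e =>
    if e = (c, d) then 0 else coset f e.1 e.2
  refine (Finset.card_le_mul_card_image (f := Φ) s _ fun b _ => ?_).trans (Nat.mul_le_mul_left _ ?_)
  · refine card_cheapFace_fiber_le hn h2 _ (fun f hf => hC f (Finset.mem_filter.1 hf).1)
      fun f hf g hg p q hpq => ?_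
    have h3 := congrFun ((Finset.mem_filter.1 hf).2.trans (Finset.mem_filter.1 hg).2.symm) (p, q)
    simpa [Φ, if_neg hpq] using h3
  · let low : Finset (BoolFun n) := Finset.univ.filter fun f => LowDeg h f
    have hlow : low.card ≤ 2 ^ (hball n h).card :=
      card_lowDeg_le low fun f hf => (Finset.mem_filter.1 hf).2
    have hsub : s.image Φ ⊆ Fintype.piFinset fun e : ZMod 2 × ZMod 2 =>
        if e = (c, d) then {0} else low := by
      intro ψ hψ
      obtain ⟨f, hf, rfl⟩ := Finset.mem_image.1 hψ
      rw [Fintype.mem_piFinset]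
      intro e
      by_cases he : e = (c, d)
      · simp [Φ, he]
      · simp only [Φ, if_neg he]
        exact Finset.mem_filter.2 ⟨Finset.mem_univ _,
          (((hC f hf).1.lowDeg hn h2).vecCons e.1).vecCons e.2⟩
    refine (Finset.card_le_card hsub).trans ?_
    rw [Fintype.card_piFinset, ← Finset.mul_prod_erase _ _ (Finset.mem_univ (c, d))]
    simp only [if_true, Finset.card_singleton, one_mul]
    rw [Finset.prod_congr rfl (g := fun _ => low.card)
      (fun e he => by rw [if_neg (Finset.ne_of_mem_erase he)]), Finset.prod_const,
      Finset.card_erase_of_mem (Finset.mem_univ _)]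
    have : (Finset.univ : Finset (ZMod 2 × ZMod 2)).card - 1 = 3 := by decide
    rw [this]
    exact Nat.pow_le_pow_left hlow 3

/-! ### Every restriction is cheap after a shear -/

/-- Sign bits are paid over the whole cube but support bits only over a ball. Since the ball is at
least half of the cube, weight two for the sign in `totalCost` suffices. -/
lemma two_pow_le_two_mul_card_hball {n h : ℕ} (hn : n + 3 = 2 * h) (h2 : 2 ≤ h) :
    2 ^ n ≤ 2 * (hball n h).card := by
  obtain ⟨k, rfl⟩ : ∃ k, h = k + 2 := ⟨h - 2, by omega⟩
  obtain rfl : n = 2 * k + 1 := by omega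
  rw [card_hball]
  have h1 : ∑ i ∈ Finset.range (k + 1), (2 * k + 1).choose i ≤
      ∑ i ∈ Finset.range (k + 2 + 1), (2 * k + 1).choose i :=
    Finset.sum_le_sum_of_subset (Finset.range_mono (by omega))
  rw [Nat.sum_range_choose_halfway] at h1
  calc 2 ^ (2 * k + 1) = 2 * 4 ^ k := by rw [pow_succ, pow_mul]; norm_num; ring
    _ ≤ _ := by omega

lemma exists_cheapFace {n h : ℕ} (hn : n + 2 + 1 = 2 * h) (h2 : 2 ≤ h) {f : BoolFun (n + 2)}
    (hf : IsBentFace f) :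
    ∃ (b : Cube n) (c d : ZMod 2) (τ : Cube n), CheapFace h c d τ fun x => f (shearSnd b x) := by
  classical
  obtain ⟨b, hb⟩ := exists_shear_sum_planeProd_nonpos f
  have hg := hf.shearSnd b
  refine ⟨b, ?_⟩
  generalize (fun x => f (shearSnd b x)) = g at hb hg
  have hT := hg.ternary hn
  let v : ZMod 2 → ZMod 2 → Cube n → SignType := fun p q y =>
    walshSign g (Matrix.vecCons p (Matrix.vecCons q y))
  have hv : ∑ y, ((v 0 0 y * v 0 1 y * v 1 0 y * v 1 1 y : SignType) : ℤ) ≤ 0 := by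
    have h3 : ∀ y, planeProd g y =
        (2 ^ h) ^ 4 * (((v 0 0 y * v 0 1 y * v 1 0 y * v 1 1 y : SignType) : ℤ) : ℝ) := by
      intro y
      unfold planeProd
      rw [hT, hT, hT, hT, SignType.intCast_cast]
      push_cast [v]
      ring
    simp_rw [h3] at hb
    rw [← Finset.mul_sum] at hb
    have h4 := nonpos_of_mul_nonpos_right hb (by positivity : (0 : ℝ) < (2 ^ h) ^ 4)
    exact_mod_cast h4
  let t : ZMod 2 → ZMod 2 → Cube n → ℕ := fun c d y =>
    totalCost (pat g c d y 0 0) (pat g c d y 0 1) (pat g c d y 1 0) (pat g c d y 1 1)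
  have ht : ∀ y, ((t 0 0 y + t 0 1 y + (t 1 0 y + t 1 1 y) : ℕ) : ℤ) =
      4 + 4 * ((v 0 0 y * v 0 1 y * v 1 0 y * v 1 1 y : SignType) : ℤ) := by
    intro y
    rw [← sum_totalCost]
    simp [t, v, pat, signChar, show (1 + 1 : ZMod 2) = 0 from rfl]
  have hsum : ∑ y, t 0 0 y + ∑ y, t 0 1 y + (∑ y, t 1 0 y + ∑ y, t 1 1 y) ≤ 4 * 2 ^ n := by
    have h3 : (((∑ y, (t 0 0 y + t 0 1 y + (t 1 0 y + t 1 1 y))) : ℕ) : ℤ) ≤ 4 * 2 ^ n := by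
      rw [Nat.cast_sum]
      simp_rw [ht]
      rw [Finset.sum_add_distrib, ← Finset.mul_sum, Finset.sum_const, Finset.card_univ, card_cube]
      push_cast [nsmul_eq_mul] at hv ⊢
      linarith
    simp only [Finset.sum_add_distrib] at h3
    exact_mod_cast h3
  -- Pigeonhole over the four possible fourth cosets.
  obtain ⟨c, d, hcd⟩ : ∃ c d, ∑ y, t c d y ≤ 2 ^ n := by
    by_contra! hcon
    have h00 := hcon 0 0
    have h01 := hcon 0 1
    have h10 := hcon 1 0
    have h11 := hcon 1 1
    omega
  obtain ⟨τ, hτ⟩ := exists_translate_sum_le h (patCost g c d)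
  refine ⟨c, d, τ, hg, ?_⟩
  have htot : ∑ y, t c d y = ∑ y, patCost g c d y +
      4 * Nat.card {y : Cube n // PatUnanimous g c d y} := by
    simp only [t, totalCost]
    rw [Finset.sum_add_distrib, ← Finset.mul_sum, ← Finset.card_filter,
      Nat.card_eq_fintype_card, Fintype.card_subtype]
    refine congrArg (_ + 4 * ·) (congrArg Finset.card ?_)
    ext y
    rw [Finset.mem_filter, Finset.mem_filter]
    rfl
  have hB := two_pow_le_two_mul_card_hball (n := n) (h := h) (by omega) h2
  rw [htot] at hcd
  generalize Nat.card {y : Cube n // PatUnanimous g c d y} = z at *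
  generalize (hball n h).card = B at *
  generalize ∑ y, patCost g c d y = C at *
  generalize ∑ x ∈ hball n h, patCost g c d (x + τ) = C' at *
  have hpos : 0 < 2 ^ n := by positivity
  generalize 2 ^ n = N at *
  refine Nat.le_of_mul_le_mul_left ?_ hpos
  calc N * (C' + 2 * z) = N * C' + 2 * z * N := by ring
    _ ≤ B * C + 2 * z * (2 * B) := by gcongr
    _ = B * (C + 4 * z) := by ring
    _ ≤ B * N := by gcongr
    _ = N * B := mul_comm _ _

/-- The number of restrictions of bent functions to a coordinate hyperplane. -/
lemma card_isBentFace_le {n h : ℕ} (hn : n + 2 + 1 = 2 * h) (h2 : 2 ≤ h) :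
    Nat.card {f : BoolFun (n + 2) // IsBentFace f} ≤
      (2 ^ n * 4 * 2 ^ n) * (Nat.sqrt (2 ^ (hball n h).card) * (2 ^ (hball n h).card) ^ 3) := by
  classical
  rw [Nat.card_eq_fintype_card, Fintype.card_subtype]
  let I := (Cube n × (ZMod 2 × ZMod 2)) × Cube n
  let A : I → Finset (BoolFun (n + 2)) := fun i =>
    (Finset.univ.filter (CheapFace h i.1.2.1 i.1.2.2 i.2)).image fun g x => g (shearSnd i.1.1 x)
  have hsub : (Finset.univ.filter fun f : BoolFun (n + 2) => IsBentFace f) ⊆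
      Finset.univ.biUnion A := by
    intro f hf
    obtain ⟨b, c, d, τ, hC⟩ := exists_cheapFace hn h2 (Finset.mem_filter.1 hf).2
    refine Finset.mem_biUnion.2 ⟨((b, (c, d)), τ), Finset.mem_univ _, Finset.mem_image.2
      ⟨_, Finset.mem_filter.2 ⟨Finset.mem_univ _, hC⟩, ?_⟩⟩
    funext x
    simp only [shearSnd_shearSnd]
  refine (Finset.card_le_card hsub).trans ((Finset.card_biUnion_le_card_mul _ A _ fun i _ =>
    Finset.card_image_le.trans (card_cheapFace_le hn h2 i.1.2.1 i.1.2.2 i.2 _ fun f hf =>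
      (Finset.mem_filter.1 hf).2)).trans (Nat.mul_le_mul_right _ ?_))
  rw [Finset.card_univ]
  simp [I, ZMod.card]

/-! ### Asymptotics -/

/-- Makes the middle binomial layers negligible against 4^k, so that the balls occupy asymptotically
half of the cube. -/
lemma two_mul_add_one_mul_centralBinom_sq_le (k : ℕ) :
    (2 * k + 1) * k.centralBinom ^ 2 ≤ (4 ^ k) ^ 2 := by
  induction k with
  | zero => simp
  | succ k ih =>
    have h1 := Nat.succ_mul_centralBinom_succ k
    have hpos : 0 < (k + 1) ^ 2 := by positivity
    refine Nat.le_of_mul_le_mul_left ?_ hpos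
    calc (k + 1) ^ 2 * ((2 * (k + 1) + 1) * (k + 1).centralBinom ^ 2)
        = (2 * k + 3) * ((k + 1) * (k + 1).centralBinom) ^ 2 := by ring
      _ = (4 * ((2 * k + 3) * (2 * k + 1))) * ((2 * k + 1) * k.centralBinom ^ 2) := by rw [h1]; ring
      _ ≤ (4 * (4 * (k + 1) ^ 2)) * (4 ^ k) ^ 2 := by
        refine Nat.mul_le_mul (Nat.mul_le_mul_left _ ?_) ih
        nlinarith
      _ = (k + 1) ^ 2 * (4 ^ (k + 1)) ^ 2 := by rw [pow_succ 4 k]; ring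

lemma centralBinom_le (k : ℕ) : (k.centralBinom : ℝ) ≤ 4 ^ k / √(2 * k + 1) := by
  have hpos : 0 < √(2 * (k : ℝ) + 1) := Real.sqrt_pos.2 (by positivity)
  rw [le_div_iff₀ hpos]
  refine (abs_le_of_sq_le_sq' ?_ (by positivity)).2
  rw [mul_pow, Real.sq_sqrt (by positivity), mul_comm]
  exact_mod_cast two_mul_add_one_mul_centralBinom_sq_le k

lemma two_mul_choose_half (k : ℕ) : 2 * (2 * k + 1).choose (k + 1) = (k + 1).centralBinom := by
  rw [Nat.centralBinom, show 2 * (k + 1) = 2 * k + 1 + 1 by ring,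
    Nat.choose_succ_succ (2 * k + 1) k, Nat.choose_symm_half k, two_mul]

/-- The size of the half-radius ball in odd dimension. -/
lemma card_hball_odd_le (k : ℕ) :
    ((hball (2 * k + 1) (k + 1)).card : ℝ) ≤ 4 ^ k * (1 + 2 / √(2 * k + 3)) := by
  have h1 : (hball (2 * k + 1) (k + 1)).card = 4 ^ k + (2 * k + 1).choose (k + 1) := by
    rw [card_hball, Finset.sum_range_succ, Nat.sum_range_choose_halfway]
  have h2 : (2 : ℝ) * ((2 * k + 1).choose (k + 1) : ℕ) = (k + 1).centralBinom := by
    exact_mod_cast two_mul_choose_half k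
  have h3 := centralBinom_le (k + 1)
  rw [show (2 * ((k + 1 : ℕ) : ℝ) + 1) = 2 * k + 3 by push_cast; ring] at h3
  rw [h1]
  push_cast
  rw [pow_succ] at h3
  have h4 : (4 : ℝ) ^ k * (1 + 2 / √(2 * k + 3)) = 4 ^ k + 4 ^ k * 4 / √(2 * k + 3) / 2 := by ring
  linarith

lemma card_hball_odd_succ_le (k : ℕ) :
    ((hball (2 * k + 1) (k + 2)).card : ℝ) ≤ 4 ^ k * (1 + 4 / √(2 * k + 3)) := by
  have h1 : (hball (2 * k + 1) (k + 2)).card ≤ 4 ^ k + (k + 1).centralBinom := by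
    rw [card_hball, Finset.sum_range_succ, Finset.sum_range_succ, Nat.sum_range_choose_halfway,
      add_assoc, ← Nat.choose_succ_succ, Nat.succ_eq_add_one, show 2 * k + 1 + 1 = 2 * (k + 1) by ring]
    exact Nat.add_le_add_left (Nat.choose_le_centralBinom _ _) _
  have h2 : ((hball (2 * k + 1) (k + 2)).card : ℝ) ≤ 4 ^ k + (k + 1).centralBinom := by
    exact_mod_cast h1
  have h3 := centralBinom_le (k + 1)
  rw [show (2 * ((k + 1 : ℕ) : ℝ) + 1) = 2 * k + 3 by push_cast; ring, pow_succ] at h3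
  have h4 : (4 : ℝ) ^ k * (1 + 4 / √(2 * k + 3)) = 4 ^ k + 4 ^ k * 4 / √(2 * k + 3) := by ring
  linarith

lemma logb_natCast_nonneg (k : ℕ) : 0 ≤ Real.logb 2 k := by
  rcases Nat.eq_zero_or_pos k with rfl | hk
  · simp
  · exact Real.logb_nonneg (by norm_num) (by exact_mod_cast hk)

/-- `log₂ a ≤ x + log₂ b` if `a ≤ 2 ^ x * b`. -/
lemma logb_le_add_of_le_mul {a b : ℕ} {x : ℝ} (hx : 0 ≤ x) (h : (a : ℝ) ≤ 2 ^ x * b) :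
    Real.logb 2 a ≤ x + Real.logb 2 b := by
  rcases Nat.eq_zero_or_pos a with rfl | ha
  · simpa using add_nonneg hx (logb_natCast_nonneg b)
  · have ha' : (0 : ℝ) < a := by exact_mod_cast ha
    have hb : (b : ℝ) ≠ 0 := by
      rintro hb
      rw [hb, mul_zero] at h
      linarith
    calc Real.logb 2 a ≤ Real.logb 2 (2 ^ x * b) := Real.logb_le_logb_of_le (by norm_num) ha' h
      _ = x + Real.logb 2 b := by
        rw [Real.logb_mul (by positivity) hb, Real.logb_rpow (by norm_num) (by norm_num)]

lemma logNumBent_le (k : ℕ) :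
    logNumBent (2 * k + 4) ≤ logNumBentRestriction (2 * k + 3) +
      4 ^ (k + 1) * (1 + 2 / √(2 * k + 5)) / 2 := by
  have h1 := card_bent_le (h := k + 2) (m := 2 * k + 3) (by ring) (by omega)
  have h2 := card_hball_odd_le (k + 1)
  rw [show (2 * ((k + 1 : ℕ) : ℝ) + 3) = 2 * k + 5 by push_cast; ring,
    show 2 * (k + 1) + 1 = 2 * k + 3 by ring, show k + 1 + 1 = k + 2 by ring] at h2
  unfold logNumBent logNumBentRestriction
  refine le_trans (logb_le_add_of_le_mul (x := (((hball (2 * k + 3) (k + 2)).card / 2 : ℕ) : ℝ))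
    (by positivity) ?_) ((add_comm _ _).trans_le (add_le_add le_rfl ?_))
  · rw [Real.rpow_natCast]
    exact_mod_cast h1
  · refine (Nat.cast_div_le).trans ?_
    push_cast
    linarith

lemma logNumBentRestriction_le (k : ℕ) :
    logNumBentRestriction (2 * k + 3) ≤
      (4 * k + 4) + 7 / 2 * (4 ^ k * (1 + 4 / √(2 * k + 3))) := by
  have hsub : Nat.card {f : BoolFun (2 * k + 3) // IsPlateaued 1 f ∧
      ∃ F : BoolFun (2 * k + 3 + 1), IsBent F ∧ IsHyperplaneRestriction f F} ≤
      Nat.card {f : BoolFun (2 * k + 3) // IsBentFace f} := by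
    refine Nat.card_le_card_of_injective (fun f => ⟨f.1, ?_⟩) fun f g hfg => ?_
    · obtain ⟨_, F, hF, hr⟩ := f.2
      exact isBentFace_of_isHyperplaneRestriction hF hr
    · exact Subtype.ext (Subtype.mk.inj hfg)
  have h1 := hsub.trans (card_isBentFace_le (n := 2 * k + 1) (h := k + 2) (by ring) (by omega))
  have h2 := card_hball_odd_succ_le k
  unfold logNumBentRestriction
  generalize Nat.card {f : BoolFun (2 * k + 3) // IsPlateaued 1 f ∧
      ∃ F : BoolFun (2 * k + 3 + 1), IsBent F ∧ IsHyperplaneRestriction f F} = a at *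
  generalize (hball (2 * k + 1) (k + 2)).card = B at *
  have hsq : ((Nat.sqrt (2 ^ B) : ℕ) : ℝ) ≤ 2 ^ ((B : ℝ) / 2) := by
    refine (Real.nat_sqrt_le_real_sqrt).trans (le_of_eq ?_)
    rw [Real.sqrt_eq_rpow, Nat.cast_pow, Nat.cast_ofNat, ← Real.rpow_natCast, ← Real.rpow_mul (by norm_num)]
    ring_nf
  have h3 : (a : ℝ) ≤ 2 ^ ((4 * k + 4 : ℝ) + 7 / 2 * B) * (1 : ℕ) := by
    have h4 : (a : ℝ) ≤ (2 ^ (2 * k + 1) * 4 * 2 ^ (2 * k + 1)) *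
        ((Nat.sqrt (2 ^ B) : ℕ) * (2 ^ B) ^ 3) := by exact_mod_cast h1
    refine h4.trans ?_
    have h5 : (2 : ℝ) ^ ((4 * k + 4 : ℝ) + 7 / 2 * B) =
        (2 ^ (2 * k + 1) * 4 * 2 ^ (2 * k + 1)) * (2 ^ ((B : ℝ) / 2) * (2 ^ B) ^ 3) := by
      have h6 : (4 * k + 4 : ℝ) + 7 / 2 * B = ((4 * k + 4 + B * 3 : ℕ) : ℝ) + B / 2 := by
        push_cast; ring
      rw [h6, Real.rpow_add (by norm_num), Real.rpow_natCast]
      ring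
    rw [h5, Nat.cast_one, mul_one]
    gcongr
  have h4 := logb_le_add_of_le_mul (by positivity) h3
  simp only [Nat.cast_one, Real.logb_one, add_zero] at h4
  linarith

lemma tendsto_const_div_sqrt_add (C c : ℝ) :
    Tendsto (fun n : ℕ => C / √((n : ℝ) + c)) atTop (𝓝 0) :=
  tendsto_const_nhds.div_atTop
    (Real.tendsto_sqrt_atTop.comp (tendsto_atTop_add_const_right _ _ tendsto_natCast_atTop_atTop))

theorem theorem2 :
    ∃ ε δ : ℕ → ℝ, Tendsto ε atTop (𝓝 0) ∧ Tendsto δ atTop (𝓝 0) ∧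
      ∀ n : ℕ, 2 ≤ n → Even n →
        logNumBent n ≤ logNumBentRestriction (n - 1) + (2 : ℝ) ^ ((n : ℝ) - 3) * (1 + ε n) ∧
        logNumBentRestriction (n - 1) + (2 : ℝ) ^ ((n : ℝ) - 3) * (1 + ε n) <
          (11 / 32 : ℝ) * (2 : ℝ) ^ n * (1 + δ n) := by
  -- For n < 4 the degree bound is unavailable, and the values are chosen to make the first
  -- inequality an equality and the second strict. They do not affect the limits.
  let ε : ℕ → ℝ := fun n =>
    if n < 4 then (logNumBent n - logNumBentRestriction (n - 1)) / (2 : ℝ) ^ ((n : ℝ) - 3) - 1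
    else 2 / √((n : ℝ) + 1)
  let δ : ℕ → ℝ := fun n =>
    if n < 4 then logNumBent n / ((11 / 32 : ℝ) * (2 : ℝ) ^ n)
    -- The last term absorbs the 4k + 4 bits naming the shear, the fourth coset and the translate (n
    -- = 2k + 4), with enough surplus for strictness.
    else 4 / √((n : ℝ) + (-1)) + 8 * (n / 2 ^ n)
  refine ⟨ε, δ, ?_, ?_, ?_⟩
  · refine (tendsto_const_div_sqrt_add 2 1).congr' ?_
    filter_upwards [eventually_ge_atTop 4] with n hn
    simp only [ε]
    rw [if_neg (by omega)]
  · have h1 : Tendsto (fun n : ℕ => (n : ℝ) / 2 ^ n) atTop (𝓝 0) := by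
      simpa using tendsto_pow_const_div_const_pow_of_one_lt 1 (by norm_num : (1 : ℝ) < 2)
    have h2 := (tendsto_const_div_sqrt_add 4 (-1)).add (h1.const_mul 8)
    rw [mul_zero, add_zero] at h2
    refine h2.congr' ?_
    filter_upwards [eventually_ge_atTop 4] with n hn
    simp only [δ]
    rw [if_neg (by omega)]
  · intro n hn2 hn
    by_cases hn4 : n < 4
    · have hp : (0 : ℝ) < (2 : ℝ) ^ ((n : ℝ) - 3) := by positivity
      have hq : (0 : ℝ) < (11 / 32 : ℝ) * (2 : ℝ) ^ n := by positivity
      have h1 : logNumBentRestriction (n - 1) + (2 : ℝ) ^ ((n : ℝ) - 3) * (1 + ε n) =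
          logNumBent n := by
        simp only [ε, if_pos hn4]
        field_simp
        ring
      have h2 : (11 / 32 : ℝ) * (2 : ℝ) ^ n * (1 + δ n) = (11 / 32 : ℝ) * (2 : ℝ) ^ n + logNumBent n := by
        simp only [δ, if_pos hn4]
        field_simp
      rw [h1, h2]
      exact ⟨le_rfl, by linarith⟩
    · obtain ⟨k, rfl⟩ : ∃ k, n = 2 * k + 4 := by
        obtain ⟨r, hr⟩ := hn
        exact ⟨r - 2, by omega⟩
      have hε : ε (2 * k + 4) = 2 / √(2 * k + 5) := by
        simp only [ε, if_neg hn4]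
        push_cast
        ring_nf
      have hδ : δ (2 * k + 4) = 4 / √(2 * k + 3) + 8 * ((2 * k + 4) / 2 ^ (2 * k + 4)) := by
        simp only [δ, if_neg hn4]
        push_cast
        ring_nf
      have hpow : (2 : ℝ) ^ (((2 * k + 4 : ℕ) : ℝ) - 3) = 2 * 4 ^ k := by
        rw [show ((2 * k + 4 : ℕ) : ℝ) - 3 = ((2 * k + 1 : ℕ) : ℝ) by push_cast; ring,
          Real.rpow_natCast, pow_succ, pow_mul]
        norm_num; ring
      have hpow' : (2 : ℝ) ^ (2 * k + 4) = 16 * 4 ^ k := by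
        rw [pow_add, pow_mul]; norm_num; ring
      have h1 := logNumBent_le k
      have h2 := logNumBentRestriction_le k
      rw [show 2 * k + 4 - 1 = 2 * k + 3 by omega, hε, hδ, hpow, hpow']
      have hX : (0 : ℝ) < 4 ^ k := by positivity
      constructor
      · rw [pow_succ] at h1
        linarith
      · have hs : 2 / √(2 * (k : ℝ) + 5) ≤ 4 / √(2 * (k : ℝ) + 3) / 2 := by
          rw [div_div, show (4 : ℝ) / (√(2 * (k : ℝ) + 3) * 2) = 2 / √(2 * (k : ℝ) + 3) by ring]
          have h3 : 0 < √(2 * (k : ℝ) + 3) := Real.sqrt_pos.2 (by positivity)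
          gcongr
          linarith
        have hs0 : 0 ≤ 4 / √(2 * (k : ℝ) + 3) := by positivity
        have h3 : (11 / 32 : ℝ) * (16 * 4 ^ k) *
            (1 + (4 / √(2 * k + 3) + 8 * ((2 * k + 4) / (16 * 4 ^ k)))) =
            11 / 2 * 4 ^ k * (1 + 4 / √(2 * k + 3)) + 11 / 4 * (2 * k + 4) := by
          field_simp
          ring
        rw [h3]
        generalize 2 / √(2 * (k : ℝ) + 5) = s at *
        generalize 4 / √(2 * (k : ℝ) + 3) = t at *
        have hk : (0 : ℝ) ≤ k := by positivity
        have h4 : (2 : ℝ) * 4 ^ k * (1 + s) ≤ 2 * 4 ^ k * (1 + t) := by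
          gcongr
          linarith
        nlinarith
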